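/- Let $\mathcal H$ (states) and $\mathcal V$ (controls) be real Hilbert spaces, $0<T<\infty$, $B\in\mathcal L(\mathcal V;\mathcal H)$, and let $N\in\mathcal L(\mathcal V;\mathcal V)$ be self-adjoint, invertible and positive, i.e. $(v,Nv)\ge 0$ for all $v\in\mathcal V$. Put $K=BN^{-1}B^*$. Let $A:\mathcal H\to\mathcal H$ be $C^1$ with $DA$ differentiable, let $F,F_T:\mathcal H\to\mathbb R$ be $C^2$, and let $\gamma,b,\nu,M,\nu_T,M_T,m,k$ be real constants such that $\nu,\nu_T,m>0$ and, for all $x,x_1,x_2,\xi\in\mathcal H$, $$A(0)=0,\qquad \|DA(x)\|\le\gamma,\qquad \|DA(x_1)-DA(x_2)\|\le\frac{b\,|x_1-x_2|}{1+\max(|x_1|,|x_2|)},$$ $$F(0)=0,\quad D_xF(0)=0,\quad \nu|\xi|^2\le (D^2_{xx}F(x)\xi,\xi)\le M|\xi|^2,$$ $$F_T(0)=0,\quad D_xF_T(0)=0,\quad \nu_T|\xi|^2\le (D^2_{xx}F_T(x)\xi,\xi)\le M_T|\xi|^2,$$ $$(K\xi,\xi)\ge m|\xi|^2,\qquad 0<k<\min(m,\nu),\qquad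 \frac{b^2}{16}<(m-k)(\nu-k),$$ $$\nu-b\alpha_0>0\ \text{ with }\ \alpha_0=\frac{M_T^2}{\nu_T}+\frac{\gamma^2+M^2}{k}\,T,\qquad \gamma^2<M\,\|K\|.$$ For $x\in\mathcal H$, $t\in[0,T]$ and a control $v\in L^2(t,T;\mathcal V)$ let $x(\cdot)$ be the solution of $\frac{dx}{ds}=A(x)+Bv(s)$ on $(t,T)$, $x(t)=x$, and set $$J_{xt}(v)=\int_t^TF(x(s))\,ds+F_T(x(T))+\frac12\int_t^T(v(s),Nv(s))\,ds,\qquad V(x,t)=\inf_{v\in L^2(t,T;\mathcal V)}J_{xt}(v).$$ For an interval $I\subseteq[0,T]$, call $W:\mathcal H\times[0,T]\to\mathbb R$ a classical solution on $I$ of the Bellman equation $$-\frac{\partial W}{\partial t}-(D_xW,A(x))+\frac12\,(D_xW,BN^{-1}B^*D_xW)=F(x),\qquad W(x,T)=F_T(x),\tag{1}$$ if $W$ is continuous on $\mathcal H\times[0,T]$; at every point of $\mathcal H\times I$ it is Fréchet differentiable in $x$ and differentiable in $t$ (one-sidedly at an endpoint of $I$ that belongs to $I$); the gradient $D_xW$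 is continuous on $\mathcal H\times I$ and locally Lipschitz in $x$ there (every $(x_0,t_0)\in\mathcal H\times I$ has a neighbourhood in $\mathcal H\times I$ on which $D_xW(\cdot,t)$ is Lipschitz with a constant independent of $t$); and the first equation of (1) holds at every point of $\mathcal H\times I$, the second at every $x\in\mathcal H$. Then the infimum defining $V(x,t)$ is finite for all $(x,t)\in\mathcal H\times[0,T]$, $V$ is a classical solution of (1) on $[0,T]$, and it is the only one: every classical solution $W$ of (1) on $(0,T)$ equals $V$ on $\mathcal H\times[0,T]$. -/

import Mathlib

/-- Data of a deterministic control problem: state space `H`, control space `U`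
(real Hilbert spaces), drift `A`, control operator `B`, invertible bounded weight `N` on the
controls, running payoff `F`, terminal payoff `FT`, horizon `T`. -/
structure ControlProblem (H U : Type*)
    [NormedAddCommGroup H] [InnerProductSpace ℝ H] [CompleteSpace H]
    [NormedAddCommGroup U] [InnerProductSpace ℝ U] [CompleteSpace U] where
  A : H → H
  B : U →L[ℝ] H
  N : U ≃L[ℝ] U
  F : H → ℝ
  FT : H → ℝ
  T : ℝ

namespace ControlProblem

variable {H U : Type*}
  [NormedAddCommGroup H] [InnerProductSpace ℝ H] [CompleteSpace H]
  [NormedAddCommGroup U] [InnerProductSpace ℝ U] [CompleteSpace U]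

/-- The bounded operator `B N⁻¹ B*` on the state space. -/
noncomputable def K (P : ControlProblem H U) : H →L[ℝ] H :=
  P.B ∘L (P.N.symm : U →L[ℝ] U) ∘L ContinuousLinearMap.adjoint P.B

/-- `v` is a control in `L²(t, T; U)`. -/
def IsControl (P : ControlProblem H U) (t : ℝ) (v : ℝ → U) : Prop :=
  MeasureTheory.MemLp v 2 (MeasureTheory.volume.restrict (Set.Ioc t P.T))

/-- `y` is the state on `[t, T]` driven by the control `v` from `y(t) = x`: the solution of
`dy/ds = A(y) + B v(s)`, written in integrated form (for `v` in `L²` this is the same as being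
an `H¹` solution). -/
def IsState (P : ControlProblem H U) (x : H) (t : ℝ) (v : ℝ → U) (y : ℝ → H) : Prop :=
  ContinuousOn y (Set.Icc t P.T) ∧
    ∀ s ∈ Set.Icc t P.T, y s = x + ∫ r in t..s, (P.A (y r) + P.B (v r))

/-- The payoff of the control `v` with state `y` on `[t, T]`. -/
noncomputable def payoff (P : ControlProblem H U) (t : ℝ) (v : ℝ → U) (y : ℝ → H) : ℝ :=
  (∫ s in t..P.T, P.F (y s)) + P.FT (y P.T)
    + (1 / 2) * ∫ s in t..P.T, inner ℝ (v s) (P.N (v s))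

/-- All values `J_{xt}(v)`, where `v` runs through the controls on `[t, T]`. -/
def payoffs (P : ControlProblem H U) (x : H) (t : ℝ) : Set ℝ :=
  {c | ∃ (v : ℝ → U) (y : ℝ → H), P.IsControl t v ∧ P.IsState x t v y ∧ c = P.payoff t v y}

/-- The value function `V(x, t) = inf_v J_{xt}(v)`. -/
noncomputable def value (P : ControlProblem H U) (x : H) (t : ℝ) : ℝ :=
  sInf (P.payoffs x t)

/-- `W` is a classical solution, at the times of the interval `I ⊆ [0, T]`, of
`-∂ₜW - (DₓW, A(x)) + ½ (DₓW, B N⁻¹ B* DₓW) = F(x)`, with `W(x, T) = FT(x)`.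
`W` is continuous on `H × [0, T]`; on `H × I` its partial derivatives exist, and
`DₓW` is jointly continuous and locally Lipschitz in `x`.
At an endpoint that belongs to `I` the time derivative is one-sided. -/
structure IsBellmanSolution (P : ControlProblem H U) (I : Set ℝ) (W : H → ℝ → ℝ) : Prop where
  continuousOn : ContinuousOn (fun p : H × ℝ => W p.1 p.2) (Set.univ ×ˢ Set.Icc 0 P.T)
  differentiableAt_state : ∀ t ∈ I, ∀ x : H, DifferentiableAt ℝ (fun x' => W x' t) x
  differentiableWithinAt_time : ∀ t ∈ I, ∀ x : H, DifferentiableWithinAt ℝ (W x) I t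
  continuousOn_gradient :
    ContinuousOn (fun p : H × ℝ => gradient (fun x' => W x' p.2) p.1) (Set.univ ×ˢ I)
  locally_lipschitz_gradient : ∀ t₀ ∈ I, ∀ x₀ : H, ∃ r > (0 : ℝ), ∃ L : ℝ,
    ∀ t ∈ I, |t - t₀| < r → ∀ x ∈ Metric.ball x₀ r, ∀ x' ∈ Metric.ball x₀ r,
      ‖gradient (fun z => W z t) x - gradient (fun z => W z t) x'‖ ≤ L * ‖x - x'‖
  equation : ∀ t ∈ I, ∀ x : H,
    -derivWithin (W x) I t - inner ℝ (gradient (fun x' => W x' t) x) (P.A x)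
      + (1 / 2) * inner ℝ (gradient (fun x' => W x' t) x)
          (P.K (gradient (fun x' => W x' t) x)) = P.F x
  terminal : ∀ x : H, W x P.T = P.FT x

end ControlProblem

/-! The proof is the method of characteristics, made global by a priori estimates. An extremal is a
pair `(x, p)` with `x' = A(x) - K p`, `-p' = DA(x)* p + DF(x)` and `p(T) = DF_T(x(T))`. Along it
`(p, x)' ≤ -k(|p|² + |x|²)`, and this dissipation gives `|p| ≤ α₀|x|`
(`norm_adjoint_le_mul_norm_state`). The decay `1/(1 + |x|)` of the modulus of `DA` then makes the
second-order Taylor remainder of the drift, paired with `p`, at most `b α₀/2` times a square, and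
since `b α₀ < ν` the convexity of `F` absorbs it. All that follows rests on this absorption.

Applied to the difference of two extremals, it shows that `p` is Lipschitz in `x` with a uniform
constant (`exists_norm_adjoint_sub_le`). Hence extremals can be continued backwards from `T` in
steps of fixed length, and one passes through every `(x, t)` (`exists_isExtremal`). Applied to an
extremal and an arbitrary controlled state, it shows that the extremal is optimal and that `p(t)` is
a subgradient of `V(·, t)` (`payoff_extremal_add_le`). Subgradients with Lipschitz dependence are
gradients, so `D_xV = p`. The time derivative is read off from the value along an extremal, which
gives the Bellman equation.

For uniqueness, let `W` be a solution. Along a curve with velocity `A(y) - K q`, the derivative of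
`W` plus the running cost is `½(K(D_xW - q), D_xW - q) ≥ 0`. Taking an extremal gives `W ≤ V`.
Equality needs a curve with `q = D_xW`, a priori only a local object. Since the inequality is an
equality on such a curve and holds on its translates, a first variation shows that `D_xW` obeys the
adjoint equation there (`inner_spatialGradient_sub`). So such a curve is a piece of a Hamiltonian
curve; those are global by linear growth and stay on the graph of `D_xW`
(`adjoint_eq_spatialGradient`). Thus `W` is the payoff of an admissible control, and `V ≤ W`. -/

section HamiltonJacobi

open Set Filter Topology MeasureTheory

/-! ### Ordinary differential equations and calculus in normed spaces. -/

section Analysis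

variable {E : Type*} [NormedAddCommGroup E] [NormedSpace ℝ E]

/-- Grönwall's inequality in both directions of time. -/
theorem norm_le_exp_mul_norm_of_norm_deriv_le {w w' : ℝ → E} {C a b : ℝ}
    (hw : ∀ s ∈ Icc a b, HasDerivWithinAt w (w' s) (Icc a b) s)
    (hC : ∀ s ∈ Icc a b, ‖w' s‖ ≤ C * ‖w s‖) :
    ∀ s ∈ Icc a b, ∀ r ∈ Icc a b, ‖w s‖ ≤ Real.exp (C * |s - r|) * ‖w r‖ := by
  have forward : ∀ {w w' : ℝ → E} {a b : ℝ},
      (∀ s ∈ Icc a b, HasDerivWithinAt w (w' s) (Icc a b) s) →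
      (∀ s ∈ Icc a b, ‖w' s‖ ≤ C * ‖w s‖) → ∀ s ∈ Icc a b, ∀ r ∈ Icc a b, r ≤ s →
      ‖w s‖ ≤ Real.exp (C * |s - r|) * ‖w r‖ := by
    intro w w' a b hw hC s hs r hr hrs
    have hsub : Icc r s ⊆ Icc a b := Icc_subset_Icc hr.1 hs.2
    have := norm_le_gronwallBound_of_norm_deriv_right_le (f := w) (f' := w') (δ := ‖w r‖) (K := C)
      (ε := 0) (a := r) (b := s)
      (fun u hu => ((hw u (hsub hu)).mono hsub).continuousWithinAt)
      (fun u hu => ((hw u (hsub (Ico_subset_Icc_self hu))).mono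
        hsub).mono_of_mem_nhdsWithin (Icc_mem_nhdsGE_of_mem hu))
      le_rfl (fun u hu => by simpa using hC u (hsub (Ico_subset_Icc_self hu))) s
      (right_mem_Icc.2 hrs)
    rw [gronwallBound_ε0] at this
    rwa [abs_of_nonneg (by linarith), mul_comm]
  intro s hs r hr
  rcases le_total r s with h | h
  · exact forward hw hC s hs r hr h
  · have hmap : MapsTo (fun u : ℝ => -u) (Icc (-b) (-a)) (Icc a b) := by
      intro u hu
      rw [mem_Icc] at hu ⊢
      constructor <;> linarith
    have key := forward (w := fun u => w (-u)) (w' := fun u => -w' (-u)) (a := -b) (b := -a)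
      (fun u hu => by
        have h1 := (hw (-u) (hmap hu)).scomp u (hasDerivAt_neg u).hasDerivWithinAt hmap
        simpa [Function.comp_def] using h1)
      (fun u hu => by simpa using hC (-u) (hmap hu)) (-s)
      ⟨by linarith [hs.2], by linarith [hs.1]⟩ (-r) ⟨by linarith [hr.2], by linarith [hr.1]⟩
      (by linarith)
    have e : |-s - -r| = |s - r| := by rw [← abs_neg]; ring_nf
    rw [e] at key
    simpa only [neg_neg] using key

/-- The radial retraction onto the ball of radius `R`. -/
noncomputable def radialRetraction (R : ℝ) (x : E) : E := (R / max R ‖x‖) • x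

theorem norm_radialRetraction_le {R : ℝ} (hR : 0 < R) (x : E) :
    ‖radialRetraction R x‖ ≤ R ∧ ‖radialRetraction R x‖ ≤ ‖x‖ := by
  have h : 0 < max R ‖x‖ := lt_max_of_lt_left hR
  rw [radialRetraction, norm_smul, Real.norm_of_nonneg (by positivity), div_mul_eq_mul_div]
  constructor
  · rw [div_le_iff₀ h]
    gcongr
    exact le_max_right _ _
  · rw [div_le_iff₀ h, mul_comm]
    gcongr
    exact le_max_left _ _

theorem radialRetraction_eq_self {R : ℝ} (hR : 0 < R) {x : E} (hx : ‖x‖ ≤ R) :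
    radialRetraction R x = x := by
  rw [radialRetraction, max_eq_left hx, div_self hR.ne', one_smul]

/-- The constant 2 rather than 1 is the price of a general norm. The application is to `H × H`,
whose norm is the maximum norm and not a Hilbert norm. -/
theorem lipschitzWith_radialRetraction {R : ℝ} (hR : 0 < R) :
    LipschitzWith 2 (radialRetraction (E := E) R) := by
  refine LipschitzWith.of_dist_le_mul fun x y => ?_
  have hx : 0 < max R ‖x‖ := lt_max_of_lt_left hR
  have hy : 0 < max R ‖y‖ := lt_max_of_lt_left hR
  rw [dist_eq_norm, dist_eq_norm]
  have e : radialRetraction R x - radialRetraction R y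
      = (R / max R ‖x‖) • (x - y) + (R / max R ‖x‖ - R / max R ‖y‖) • y := by
    simp only [radialRetraction]
    module
  have h1 : ‖(R / max R ‖x‖) • (x - y)‖ ≤ ‖x - y‖ := by
    rw [norm_smul, Real.norm_of_nonneg (by positivity)]
    refine mul_le_of_le_one_left (norm_nonneg _) ?_
    rw [div_le_one hx]
    exact le_max_left _ _
  have h2 : ‖(R / max R ‖x‖ - R / max R ‖y‖) • y‖ ≤ ‖x - y‖ := by
    have e2 : R / max R ‖x‖ - R / max R ‖y‖
        = (R / max R ‖x‖) * ((max R ‖y‖ - max R ‖x‖) / max R ‖y‖) := by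
      field_simp
    rw [norm_smul, e2, norm_mul, Real.norm_of_nonneg (show 0 ≤ R / max R ‖x‖ by positivity),
      norm_div, Real.norm_of_nonneg hy.le]
    have h3 : ‖max R ‖y‖ - max R ‖x‖‖ ≤ ‖x - y‖ := by
      rw [Real.norm_eq_abs]
      refine (abs_max_sub_max_le_max R ‖y‖ R ‖x‖).trans ?_
      rw [sub_self, abs_zero, norm_sub_rev]
      exact max_le (norm_nonneg _) (abs_norm_sub_norm_le _ _)
    have h4 : R / max R ‖x‖ ≤ 1 := by
      rw [div_le_one hx]
      exact le_max_left _ _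
    calc R / max R ‖x‖ * (‖max R ‖y‖ - max R ‖x‖‖ / max R ‖y‖) * ‖y‖
        ≤ 1 * (‖x - y‖ / max R ‖y‖) * ‖y‖ := by gcongr
      _ = ‖x - y‖ * (‖y‖ / max R ‖y‖) := by ring
      _ ≤ ‖x - y‖ * 1 := by
          gcongr
          rw [div_le_one hy]
          exact le_max_right _ _
      _ = ‖x - y‖ := mul_one _
  rw [e]
  refine (norm_add_le _ _).trans ?_
  push_cast
  linarith

/-- An autonomous ODE whose field is Lipschitz on balls and of linear growth is solvable on every
bounded time interval. -/
theorem exists_hasDerivAt_of_linear_growth [CompleteSpace E] {v : E → E} {C : ℝ}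
    (hlip : ∀ R : ℝ, ∃ L : NNReal, LipschitzOnWith L v (Metric.closedBall 0 R))
    (hC : ∀ w, ‖v w‖ ≤ C * ‖w‖) (a b t₀ : ℝ) (ht₀ : t₀ ∈ Icc a b) (w₀ : E) :
    ∃ w : ℝ → E, w t₀ = w₀ ∧ ∀ s ∈ Ioo a b, HasDerivAt w (v (w s)) s := by
  have hC' : ∀ w, ‖v w‖ ≤ |C| * ‖w‖ := fun w =>
    (hC w).trans (mul_le_mul_of_nonneg_right (le_abs_self C) (norm_nonneg _))
  -- Grönwall bound for solutions of the truncated field, plus 1 to make it positive. Truncation at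
  -- this radius makes the field globally Lipschitz and bounded, so Picard–Lindelöf covers `[a, b]`
  -- at once, and the solution never feels the truncation.
  set R : ℝ := Real.exp (|C| * (b - a)) * ‖w₀‖ + 1 with hR
  have hRpos : 0 < R := by positivity
  obtain ⟨L, hL⟩ := hlip R
  set u : E → E := fun w => v (radialRetraction R w) with hu
  have hmem : ∀ w, radialRetraction R w ∈ Metric.closedBall (0 : E) R := fun w => by
    simpa using (norm_radialRetraction_le hRpos w).1
  have hulip : LipschitzWith (L * 2) u := by
    rw [← lipschitzOnWith_univ]
    exact hL.comp (lipschitzWith_radialRetraction hRpos).lipschitzOnWith fun w _ => hmem w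
  have hunorm : ∀ w, ‖u w‖ ≤ |C| * ‖w‖ := fun w => (hC' _).trans <|
    mul_le_mul_of_nonneg_left (norm_radialRetraction_le hRpos w).2 (abs_nonneg C)
  have hubd : ∀ w, ‖u w‖ ≤ |C| * R := fun w => (hC' _).trans <|
    mul_le_mul_of_nonneg_left (norm_radialRetraction_le hRpos w).1 (abs_nonneg C)
  have hab : a ≤ b := ht₀.1.trans ht₀.2
  let B : NNReal := ⟨|C| * R, by positivity⟩
  let D : NNReal := ⟨b - a, by linarith⟩
  have hPL : IsPicardLindelof (fun _ => u) (⟨t₀, ht₀⟩ : Icc a b) w₀ (B * D) 0 B (L * 2) := by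
    refine ⟨fun t _ => hulip.lipschitzOnWith, fun _ _ => continuousOn_const, fun _ _ w _ => hubd w,
      ?_⟩
    have : max (b - t₀) (t₀ - a) ≤ b - a := max_le (by linarith [ht₀.1]) (by linarith [ht₀.2])
    have h : |C| * R * max (b - t₀) (t₀ - a) ≤ |C| * R * (b - a) :=
      mul_le_mul_of_nonneg_left this B.2
    change (B : ℝ) * max (b - t₀) (t₀ - a) ≤ ((B * D : NNReal) : ℝ) - ((0 : NNReal) : ℝ)
    rw [NNReal.coe_mul, NNReal.coe_zero, sub_zero]
    exact h
  obtain ⟨w, hw0, hw⟩ := hPL.exists_eq_forall_mem_Icc_hasDerivWithinAt₀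
  refine ⟨w, hw0, fun s hs => ?_⟩
  have hbound := norm_le_exp_mul_norm_of_norm_deriv_le hw (fun s _ => hunorm (w s)) s
    (Ioo_subset_Icc_self hs) t₀ ht₀
  have h1 : |s - t₀| ≤ b - a := by
    rw [abs_le]
    constructor <;> linarith [hs.1, hs.2, ht₀.1, ht₀.2]
  have h2 : ‖w s‖ ≤ R := by
    rw [show w t₀ = w₀ from hw0] at hbound
    have : Real.exp (|C| * |s - t₀|) ≤ Real.exp (|C| * (b - a)) := by gcongr
    nlinarith [norm_nonneg w₀]
  have h3 := (hw s (Ioo_subset_Icc_self hs)).hasDerivAt (Icc_mem_nhds hs.1 hs.2)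
  simpa [hu, radialRetraction_eq_self hRpos h2] using h3

theorem hasDerivAt_integral_of_continuousOn_Ioo [CompleteSpace E] {h : ℝ → E} {a b c s : ℝ}
    (hc : ContinuousOn h (Ioo a b)) (hcm : c ∈ Ioo a b) (hs : s ∈ Ioo a b) :
    HasDerivAt (fun r => ∫ u in c..r, h u) (h s) s := by
  refine intervalIntegral.integral_hasDerivAt_right ?_ ?_ ?_
  · refine (hc.mono ?_).intervalIntegrable
    exact (convex_Ioo a b).ordConnected.uIcc_subset hcm hs
  · exact hc.stronglyMeasurableAtFilter isOpen_Ioo s hs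
  · exact hc.continuousAt (isOpen_Ioo.mem_nhds hs)

theorem AbsolutelyContinuousOnInterval.of_dist_le {X Y : Type*} [PseudoMetricSpace X]
    [PseudoMetricSpace Y] {f : ℝ → X} {g : ℝ → Y} {a b C : ℝ}
    (hg : AbsolutelyContinuousOnInterval g a b)
    (h : ∀ s ∈ uIcc a b, ∀ r ∈ uIcc a b, dist (f s) (f r) ≤ C * dist (g s) (g r)) :
    AbsolutelyContinuousOnInterval f a b := by
  have h0 := Filter.Tendsto.const_mul C hg
  rw [mul_zero] at h0
  refine squeeze_zero' (Eventually.of_forall fun _ => Finset.sum_nonneg fun _ _ => dist_nonneg) ?_ h0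
  filter_upwards [mem_inf_of_right (mem_principal_self _)] with I hI
  rw [Finset.mul_sum]
  exact Finset.sum_le_sum fun i hi => h _ (hI.1 i hi).1 _ (hI.1 i hi).2

/-- Comparison along the segment with `θ ↦ L/2 · ‖y - x‖² θ²` keeps the factor 1/2 that a plain mean
value inequality loses. The thresholds `b²/16` and `b α₀ < ν` depend on that factor. -/
theorem norm_sub_sub_le_of_norm_fderiv_sub_le {E' : Type*} [NormedAddCommGroup E']
    [NormedSpace ℝ E'] {A : E → E'} (hA : Differentiable ℝ A) {L : ℝ} (x y : E)
    (hL : ∀ θ ∈ Icc (0 : ℝ) 1,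
      ‖fderiv ℝ A (x + θ • (y - x)) - fderiv ℝ A x‖ ≤ L * (θ * ‖y - x‖)) :
    ‖A y - A x - fderiv ℝ A x (y - x)‖ ≤ L / 2 * ‖y - x‖ ^ 2 := by
  have hline : ∀ θ : ℝ, HasDerivAt (fun θ : ℝ => x + θ • (y - x)) (y - x) θ := fun θ => by
    simpa using ((hasDerivAt_id θ).smul_const (y - x)).const_add x
  have hd : ∀ θ : ℝ, HasDerivAt
      (fun θ : ℝ => A (x + θ • (y - x)) - A x - θ • fderiv ℝ A x (y - x))
      (fderiv ℝ A (x + θ • (y - x)) (y - x) - fderiv ℝ A x (y - x)) θ := fun θ => by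
    have h1 := ((hA _).hasFDerivAt (x := x + θ • (y - x))).comp_hasDerivAt θ (hline θ)
    have h2 := (hasDerivAt_id θ).smul_const (fderiv ℝ A x (y - x))
    simpa using (h1.sub_const (A x)).fun_sub h2
  have := image_norm_le_of_norm_deriv_right_le_deriv_boundary (a := 0) (b := 1)
    (f := fun θ : ℝ => A (x + θ • (y - x)) - A x - θ • fderiv ℝ A x (y - x))
    (B := fun θ => L / 2 * ‖y - x‖ ^ 2 * θ ^ 2) (B' := fun θ => L * ‖y - x‖ ^ 2 * θ)
    (fun θ _ => (hd θ).continuousAt.continuousWithinAt)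
    (fun θ _ => (hd θ).hasDerivWithinAt) (by simp)
    (fun θ => by
      refine ((hasDerivAt_pow 2 θ).const_mul (L / 2 * ‖y - x‖ ^ 2)).congr_deriv ?_
      push_cast
      ring)
    (fun θ hθ => by
      rw [← sub_apply]
      refine (ContinuousLinearMap.le_opNorm _ _).trans ?_
      have := mul_le_mul_of_nonneg_right (hL θ (Ico_subset_Icc_self hθ)) (norm_nonneg (y - x))
      linarith)
    (right_mem_Icc.2 zero_le_one)
  simpa using this

end Analysis

/-! ### Bilinear estimates in Hilbert space and the dissipation lemma. -/

section Inner

variable {H : Type*} [NormedAddCommGroup H] [InnerProductSpace ℝ H]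

theorem hasDerivAt_line (x h : H) (θ : ℝ) : HasDerivAt (fun θ : ℝ => x + θ • h) h θ := by
  simpa using ((hasDerivAt_id θ).smul_const h).const_add x

/-- The norm of a symmetric positive semidefinite bilinear form is bounded by its values on the
diagonal. -/
theorem opNorm_le_of_symm_of_nonneg {E : Type*} [NormedAddCommGroup E] [NormedSpace ℝ E]
    {Q : E →L[ℝ] E →L[ℝ] ℝ} {M : ℝ}
    (hs : ∀ x y, Q x y = Q y x) (h0 : ∀ x, 0 ≤ Q x x) (hM : ∀ x, Q x x ≤ M * ‖x‖ ^ 2)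
    (hM0 : 0 ≤ M) : ‖Q‖ ≤ M := by
  refine ContinuousLinearMap.opNorm_le_bound₂ _ hM0 fun x y => ?_
  have cs : Q x y ^ 2 ≤ Q x x * Q y y := by
    have hq : ∀ t : ℝ, 0 ≤ Q y y * (t * t) + 2 * Q x y * t + Q x x := fun t => by
      have := h0 (x + t • y)
      simp only [map_add, map_smul, add_apply, smul_apply,
        smul_eq_mul, hs y x] at this
      linarith
    have := discrim_le_zero hq
    rw [discrim] at this
    linarith
  have h1 : Q x y ^ 2 ≤ (M * ‖x‖ * ‖y‖) ^ 2 := by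
    calc Q x y ^ 2 ≤ Q x x * Q y y := cs
      _ ≤ (M * ‖x‖ ^ 2) * (M * ‖y‖ ^ 2) :=
          mul_le_mul (hM x) (hM y) (h0 y) (by positivity)
      _ = (M * ‖x‖ * ‖y‖) ^ 2 := by ring
  rw [Real.norm_eq_abs]
  exact abs_le_of_sq_le_sq h1 (by positivity)

/-- Integration by parts for a `C¹` curve and the primitive of an integrable function. -/
theorem integral_inner_add_inner_eq_sub [CompleteSpace H] {p p' X g : ℝ → H} {a b : ℝ} {X₀ : H}
    (hab : a ≤ b) (hp : ∀ s ∈ Icc a b, HasDerivAt p (p' s) s) (hp' : ContinuousOn p' (Icc a b))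
    (hg : IntervalIntegrable g volume a b) (hX : ∀ s ∈ Icc a b, X s = X₀ + ∫ r in a..s, g r) :
    ∫ s in a..b, (inner ℝ (p' s) (X s) + inner ℝ (p s) (g s))
      = inner ℝ (p b) (X b) - inner ℝ (p a) (X a) := by
  set Y : ℝ → H := fun s => X₀ + ∫ r in a..s, g r with hY
  have huIcc : uIcc a b = Icc a b := uIcc_of_le hab
  have hpc : ContinuousOn p (Icc a b) := fun s hs => (hp s hs).continuousAt.continuousWithinAt
  have hYc : ContinuousOn Y (Icc a b) := by
    have := intervalIntegral.continuousOn_primitive_interval' hg (left_mem_uIcc)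
    rw [huIcc] at this
    exact continuousOn_const.add this
  obtain ⟨C₁, hC₁⟩ := isCompact_Icc.exists_bound_of_continuousOn hpc
  obtain ⟨C₂, hC₂⟩ := isCompact_Icc.exists_bound_of_continuousOn hYc
  obtain ⟨C₃, hC₃⟩ := isCompact_Icc.exists_bound_of_continuousOn hp'
  have hC₁0 : 0 ≤ C₁ := (norm_nonneg _).trans (hC₁ a (left_mem_Icc.2 hab))
  have hC₂0 : 0 ≤ C₂ := (norm_nonneg _).trans (hC₂ a (left_mem_Icc.2 hab))
  have hC₃0 : 0 ≤ C₃ := (norm_nonneg _).trans (hC₃ a (left_mem_Icc.2 hab))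
  have hsubint : ∀ s ∈ Icc a b, ∀ r ∈ Icc a b, IntervalIntegrable g volume s r := by
    intro s hs r hr
    refine hg.mono_set ?_
    rw [huIcc]
    exact ordConnected_Icc.uIcc_subset hs hr
  have hmaj : IntervalIntegrable (fun r => C₁ * ‖g r‖ + C₂ * C₃) volume a b :=
    (hg.norm.const_mul C₁).add intervalIntegrable_const
  -- With an `L²` control the state has a derivative only almost everywhere, so the product rule is
  -- integrated through absolute continuity: increments of the pairing are dominated by those of the
  -- primitive of `C₁‖g‖ + C₂C₃`.
  have hac : AbsolutelyContinuousOnInterval (fun s => (inner ℝ (p s) (Y s) : ℝ)) a b := by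
    refine (hmaj.absolutelyContinuousOnInterval_intervalIntegral
      left_mem_uIcc).of_dist_le (C := 1) ?_
    rw [huIcc]
    have key : ∀ s ∈ Icc a b, ∀ r ∈ Icc a b, r ≤ s →
        dist (inner ℝ (p s) (Y s) : ℝ) (inner ℝ (p r) (Y r)) ≤
        ∫ u in r..s, (C₁ * ‖g u‖ + C₂ * C₃) := by
      intro s hs r hr hrs
      have hgi := hsubint r hr s hs
      have e1 : Y s - Y r = ∫ u in r..s, g u := by
        simp only [hY, add_sub_add_left_eq_sub]
        exact intervalIntegral.integral_interval_sub_left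
          (hsubint a (left_mem_Icc.2 hab) s hs) (hsubint a (left_mem_Icc.2 hab) r hr)
      have e2 : ‖Y s - Y r‖ ≤ ∫ u in r..s, ‖g u‖ := by
        rw [e1]
        exact intervalIntegral.norm_integral_le_integral_norm hrs
      have e3 : ‖p s - p r‖ ≤ C₃ * (s - r) := by
        have := (convex_Icc a b).norm_image_sub_le_of_norm_hasDerivWithin_le
          (fun u hu => (hp u hu).hasDerivWithinAt) hC₃ hr hs
        rwa [Real.norm_of_nonneg (by linarith)] at this
      have e4 : (inner ℝ (p s) (Y s) : ℝ) - inner ℝ (p r) (Y r)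
          = inner ℝ (p s) (Y s - Y r) + inner ℝ (p s - p r) (Y r) := by
        simp only [inner_sub_left, inner_sub_right]
        ring
      have e5 : (∫ u in r..s, (C₁ * ‖g u‖ + C₂ * C₃))
          = C₁ * (∫ u in r..s, ‖g u‖) + C₂ * C₃ * (s - r) := by
        rw [intervalIntegral.integral_add (hgi.norm.const_mul C₁) intervalIntegrable_const,
          intervalIntegral.integral_const_mul, intervalIntegral.integral_const, smul_eq_mul]
        ring
      rw [Real.dist_eq, e4, e5]
      refine (abs_add_le _ _).trans (add_le_add ?_ ?_)
      · exact (abs_real_inner_le_norm _ _).trans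
          (mul_le_mul (hC₁ s hs) e2 (norm_nonneg _) hC₁0)
      · refine (abs_real_inner_le_norm _ _).trans ?_
        calc ‖p s - p r‖ * ‖Y r‖ ≤ (C₃ * (s - r)) * C₂ :=
              mul_le_mul e3 (hC₂ r hr) (norm_nonneg _) ((norm_nonneg _).trans e3)
          _ = C₂ * C₃ * (s - r) := by ring
    have key' : ∀ s ∈ Icc a b, ∀ r ∈ Icc a b, r ≤ s →
        dist (inner ℝ (p s) (Y s) : ℝ) (inner ℝ (p r) (Y r)) ≤
        1 * dist (∫ u in a..s, (C₁ * ‖g u‖ + C₂ * C₃)) (∫ u in a..r, (C₁ * ‖g u‖ + C₂ * C₃)) := by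
      intro s hs r hr hrs
      have hsub : ∀ q ∈ Icc a b, IntervalIntegrable (fun r => C₁ * ‖g r‖ + C₂ * C₃) volume a q :=
        fun q hq => hmaj.mono_set (by
          rw [huIcc]
          exact ordConnected_Icc.uIcc_subset (left_mem_Icc.2 hab) hq)
      rw [Real.dist_eq (∫ u in a..s, _), intervalIntegral.integral_interval_sub_left (hsub s hs)
        (hsub r hr), one_mul]
      exact (key s hs r hr hrs).trans (le_abs_self _)
    intro s hs r hr
    rcases le_total r s with h | h
    · exact key' s hs r hr h
    · rw [dist_comm, dist_comm (∫ u in a..s, _)]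
      exact key' r hr s hs h
  have hY' : ∀ s ∈ Icc a b, X s = Y s := hX
  rw [hY' b (right_mem_Icc.2 hab), hY' a (left_mem_Icc.2 hab), ← hac.integral_deriv_eq_sub]
  refine intervalIntegral.integral_congr_ae ?_
  filter_upwards [hg.ae_hasDerivAt_integral] with s hs hsI
  have hsI' : s ∈ Icc a b := by
    rw [uIoc_of_le hab] at hsI
    exact Ioc_subset_Icc_self hsI
  have h1 : HasDerivAt Y (g s) s :=
    (hs (huIcc ▸ hsI') a left_mem_uIcc).const_add X₀
  rw [((hp s hsI').inner ℝ h1).deriv, hY' s hsI', add_comm]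

/-- The adjoint variable is bounded by the state, with an explicit constant. -/
theorem norm_le_mul_norm_of_inner_dissipation {x p x' p' : ℝ → H} {a T k γ M νT MT τ : ℝ}
    (haT : a ≤ T) (hτ : T - a ≤ τ) (hk : 0 < k) (hνT : 0 < νT) (hMT : 0 < MT)
    (hx : ∀ s ∈ Icc a T, HasDerivAt x (x' s) s) (hp : ∀ s ∈ Icc a T, HasDerivAt p (p' s) s)
    (hdiss : ∀ s ∈ Icc a T, inner ℝ (p s) (x' s) + inner ℝ (p' s) (x s)
      ≤ -(k * (‖p s‖ ^ 2 + ‖x s‖ ^ 2)))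
    (hp' : ∀ s ∈ Icc a T, ‖p' s‖ ≤ γ * ‖p s‖ + M * ‖x s‖)
    (hT1 : νT * ‖x T‖ ^ 2 ≤ inner ℝ (p T) (x T)) (hT2 : ‖p T‖ ≤ MT * ‖x T‖) :
    νT * ‖x T‖ ^ 2 ≤ inner ℝ (p a) (x a) ∧
    ‖p a‖ ≤ (MT ^ 2 / νT + (γ ^ 2 + M ^ 2) / k * τ) * ‖x a‖ := by
  set Q : ℝ → ℝ := fun s => inner ℝ (p s) (x s) with hQ
  have hQd : ∀ s ∈ Icc a T, HasDerivAt Q (inner ℝ (p s) (x' s) + inner ℝ (p' s) (x s)) s :=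
    fun s hs => (hp s hs).inner ℝ (hx s hs)
  have hQanti : Q T ≤ Q a := by
    have : AntitoneOn Q (Icc a T) := by
      refine antitoneOn_of_deriv_nonpos (convex_Icc a T)
        (fun s hs => (hQd s hs).continuousAt.continuousWithinAt)
        (fun s hs => (hQd s (interior_subset hs)).differentiableAt.differentiableWithinAt) ?_
      intro s hs
      rw [(hQd s (interior_subset hs)).deriv]
      refine (hdiss s (interior_subset hs)).trans ?_
      have : 0 ≤ k * (‖p s‖ ^ 2 + ‖x s‖ ^ 2) := by positivity
      linarith
    exact this (left_mem_Icc.2 haT) (right_mem_Icc.2 haT) haT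
  have hQa : νT * ‖x T‖ ^ 2 ≤ Q a := hT1.trans hQanti
  refine ⟨hQa, ?_⟩
  set α : ℝ := MT ^ 2 / νT + (γ ^ 2 + M ^ 2) / k * τ with hα
  have hτ0 : 0 ≤ τ := by linarith
  have hαpos : 0 < α := by positivity
  -- Young's inequality with a free weight `l`: the growth of `p` is paid for by the loss of `Q`.
  -- The weight is optimised at the end.
  have key : ∀ l : ℝ, 0 < l → ‖p a‖ ≤ (l * α + Q a / l) / 2 := by
    intro l hl
    have hBd : ∀ s ∈ Icc a T, HasDerivAt
        (fun s => l / 2 * ((γ ^ 2 + M ^ 2) / k) * (s - a) + (Q a - Q s) / (2 * l))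
        (l / 2 * ((γ ^ 2 + M ^ 2) / k)
          + (-(inner ℝ (p s) (x' s) + inner ℝ (p' s) (x s))) / (2 * l)) s := by
      intro s hs
      have h1 := ((hasDerivAt_id s).sub_const a).const_mul (l / 2 * ((γ ^ 2 + M ^ 2) / k))
      have h2 := ((hQd s hs).const_sub (Q a)).div_const (2 * l)
      simpa using h1.fun_add h2
    -- The barrier combines a term linear in time with the dissipated amount `Q a - Q s`. Its
    -- derivative dominates `γ‖p‖ + M‖x‖` because the difference is a sum of two squares.
    have hfence := image_norm_le_of_norm_deriv_right_le_deriv_boundary' (a := a) (b := T)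
      (f := fun s => p s - p a) (f' := p')
      (fun s hs => ((hp s hs).continuousAt.sub continuousAt_const).continuousWithinAt)
      (fun s hs => ((hp s (Ico_subset_Icc_self hs)).sub_const (p a)).hasDerivWithinAt)
      (by simp) (fun s hs => (hBd s hs).continuousAt.continuousWithinAt)
      (fun s hs => (hBd s (Ico_subset_Icc_self hs)).hasDerivWithinAt)
      (fun s hs => by
        have hs' := Ico_subset_Icc_self hs
        refine (hp' s hs').trans ?_
        have h1 : k * (‖p s‖ ^ 2 + ‖x s‖ ^ 2) / (2 * l)
            ≤ (-(inner ℝ (p s) (x' s) + inner ℝ (p' s) (x s))) / (2 * l) := by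
          gcongr
          linarith [hdiss s hs']
        refine le_trans ?_ (add_le_add le_rfl h1)
        have h2 : l / 2 * ((γ ^ 2 + M ^ 2) / k) + k * (‖p s‖ ^ 2 + ‖x s‖ ^ 2) / (2 * l)
            - (γ * ‖p s‖ + M * ‖x s‖)
            = ((l * γ - k * ‖p s‖) ^ 2 + (l * M - k * ‖x s‖) ^ 2) / (2 * l * k) := by
          field_simp
          ring
        have h3 : 0 ≤ ((l * γ - k * ‖p s‖) ^ 2 + (l * M - k * ‖x s‖) ^ 2) / (2 * l * k) := by
          positivity
        linarith)
      (right_mem_Icc.2 haT)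
    have h4 : ‖p a‖ ≤ ‖p T‖ + ‖p T - p a‖ := by
      rw [norm_sub_rev]
      have := norm_add_le (p T) (p a - p T)
      simpa using this
    have h5 : MT * ‖x T‖ ≤ l / 2 * (MT ^ 2 / νT) + νT * ‖x T‖ ^ 2 / (2 * l) := by
      have : l / 2 * (MT ^ 2 / νT) + νT * ‖x T‖ ^ 2 / (2 * l) - MT * ‖x T‖
          = (l * MT - νT * ‖x T‖) ^ 2 / (2 * l * νT) := by
        field_simp
        ring
      have h6 : 0 ≤ (l * MT - νT * ‖x T‖) ^ 2 / (2 * l * νT) := by positivity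
      linarith
    have h7 : l / 2 * ((γ ^ 2 + M ^ 2) / k) * (T - a) ≤ l / 2 * ((γ ^ 2 + M ^ 2) / k) * τ := by
      gcongr
    have h8 : νT * ‖x T‖ ^ 2 / (2 * l) ≤ Q T / (2 * l) := by gcongr
    have h9 : (l * α + Q a / l) / 2 = l / 2 * (MT ^ 2 / νT) + l / 2 * ((γ ^ 2 + M ^ 2) / k) * τ
        + Q T / (2 * l) + (Q a - Q T) / (2 * l) := by
      rw [hα]
      field_simp
      ring
    rw [h9]
    linarith
  rcases (norm_nonneg (p a)).eq_or_lt with h0 | h0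
  · rw [← h0]
    positivity
  -- This weight turns the bound into `‖p a‖² ≤ α Q(a)`, and `Q(a) ≤ ‖p a‖ ‖x a‖`.
  · have h1 := key (‖p a‖ / α) (by positivity)
    have h2 : Q a ≤ ‖p a‖ * ‖x a‖ := real_inner_le_norm _ _
    have h3 : Q a / (‖p a‖ / α) ≤ α * ‖x a‖ := by
      rw [div_le_iff₀ (by positivity)]
      refine h2.trans (le_of_eq ?_)
      field_simp
    have h4 : ‖p a‖ / α * α = ‖p a‖ := by field_simp
    linarith

end Inner

/-! ### Consequences of two-sided Hessian bounds. -/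

section Convex

variable {H : Type*} [NormedAddCommGroup H] [InnerProductSpace ℝ H] [CompleteSpace H]

theorem norm_gradient_sub_eq (F : H → ℝ) (x y : H) :
    ‖gradient F x - gradient F y‖ = ‖fderiv ℝ F x - fderiv ℝ F y‖ := by
  rw [gradient, gradient, ← map_sub, LinearIsometryEquiv.norm_map]

/-- The Hessian is symmetric and nonnegative, so Cauchy–Schwarz turns its bound on the diagonal into
an operator norm bound; the mean value inequality does the rest. -/
theorem norm_gradient_sub_le_of_hessian_le {F : H → ℝ} (hF : ContDiff ℝ 2 F) {a M : ℝ}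
    (ha : 0 ≤ a) (hM0 : 0 ≤ M)
    (hlow : ∀ x ξ : H, a * ‖ξ‖ ^ 2 ≤ fderiv ℝ (fderiv ℝ F) x ξ ξ)
    (hup : ∀ x ξ : H, fderiv ℝ (fderiv ℝ F) x ξ ξ ≤ M * ‖ξ‖ ^ 2) (x y : H) :
    ‖gradient F x - gradient F y‖ ≤ M * ‖x - y‖ := by
  have hd : Differentiable ℝ (fderiv ℝ F) :=
    (hF.fderiv_right (m := 1) (by norm_num)).differentiable (by norm_num)
  rw [norm_gradient_sub_eq]
  refine convex_univ.norm_image_sub_le_of_norm_fderiv_le (𝕜 := ℝ) (fun z _ => hd z) (fun z _ => ?_)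
    (mem_univ y) (mem_univ x)
  have hs : IsSymmSndFDerivAt ℝ F z := hF.contDiffAt.isSymmSndFDerivAt (by simp)
  exact opNorm_le_of_symm_of_nonneg (fun u v => hs u v)
    (fun u => (by positivity : 0 ≤ a * ‖u‖ ^ 2).trans (hlow z u)) (hup z) hM0

theorem le_of_hessian_ge {F : H → ℝ} (hF : ContDiff ℝ 2 F) {a : ℝ}
    (hlow : ∀ x ξ : H, a * ‖ξ‖ ^ 2 ≤ fderiv ℝ (fderiv ℝ F) x ξ ξ) (x y : H) :
    F x + inner ℝ (gradient F x) (y - x) + a / 2 * ‖y - x‖ ^ 2 ≤ F y := by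
  have hd1 : Differentiable ℝ F := hF.differentiable (by norm_num)
  have hd2 : Differentiable ℝ (fderiv ℝ F) :=
    (hF.fderiv_right (m := 1) (by norm_num)).differentiable (by norm_num)
  set h := y - x with hh
  have h1 : ∀ θ : ℝ, HasDerivAt (fun θ : ℝ => F (x + θ • h)) (fderiv ℝ F (x + θ • h) h) θ :=
    fun θ => (hd1 _).hasFDerivAt.comp_hasDerivAt θ (hasDerivAt_line x h θ)
  have h2 : ∀ θ : ℝ, HasDerivAt (fun θ : ℝ => fderiv ℝ F (x + θ • h) h)
      (fderiv ℝ (fderiv ℝ F) (x + θ • h) h h) θ := fun θ => by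
    have := (hd2 (x + θ • h)).hasFDerivAt.comp_hasDerivAt θ (hasDerivAt_line x h θ)
    simpa using this.clm_apply (hasDerivAt_const θ h)
  -- The Hessian bound is integrated twice along the segment, each time as the monotonicity of a
  -- corrected function.
  have mono1 : Monotone (fun θ : ℝ => fderiv ℝ F (x + θ • h) h - a * ‖h‖ ^ 2 * θ) := by
    refine monotone_of_hasDerivAt_nonneg
      (fun θ => (h2 θ).fun_sub ((hasDerivAt_id θ).const_mul (a * ‖h‖ ^ 2))) fun θ => ?_
    have := hlow (x + θ • h) h
    simp only [Pi.zero_apply]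
    linarith
  have mono2 : MonotoneOn (fun θ : ℝ => F (x + θ • h) - fderiv ℝ F x h * θ - a / 2 * ‖h‖ ^ 2 * θ ^ 2)
      (Icc 0 1) := by
    have hder : ∀ θ : ℝ, HasDerivAt
        (fun θ : ℝ => F (x + θ • h) - fderiv ℝ F x h * θ - a / 2 * ‖h‖ ^ 2 * θ ^ 2)
        (fderiv ℝ F (x + θ • h) h - fderiv ℝ F x h * 1 - a / 2 * ‖h‖ ^ 2 * (2 * θ)) θ := fun θ => by
      have h3 := (hasDerivAt_pow 2 θ).const_mul (a / 2 * ‖h‖ ^ 2)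
      exact (((h1 θ).fun_sub ((hasDerivAt_id θ).const_mul (fderiv ℝ F x h))).fun_sub h3).congr_deriv
        (by simp)
    refine monotoneOn_of_deriv_nonneg (convex_Icc 0 1)
      (fun θ _ => (hder θ).continuousAt.continuousWithinAt)
      (fun θ _ => (hder θ).differentiableAt.differentiableWithinAt) fun θ hθ => ?_
    rw [(hder θ).deriv]
    have := mono1 (interior_subset hθ).1
    simp only [zero_smul, add_zero, mul_zero, sub_zero] at this
    linarith
  have := mono2 (left_mem_Icc.2 zero_le_one) (right_mem_Icc.2 zero_le_one) zero_le_one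
  simp only [zero_smul, add_zero, one_smul, hh, add_sub_cancel] at this
  rw [inner_gradient_left, hh]
  linarith

/-- Since `le_of_hessian_ge` asks nothing about the sign of its constant, it applies to `-F` with
`-a`. -/
theorem le_of_hessian_le {F : H → ℝ} (hF : ContDiff ℝ 2 F) {a : ℝ}
    (hup : ∀ x ξ : H, fderiv ℝ (fderiv ℝ F) x ξ ξ ≤ a * ‖ξ‖ ^ 2) (x y : H) :
    F y ≤ F x + inner ℝ (gradient F x) (y - x) + a / 2 * ‖y - x‖ ^ 2 := by
  have hfd : fderiv ℝ (fun x => -F x) = fun x => -fderiv ℝ F x := funext fun z => fderiv_fun_neg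
  have := le_of_hessian_ge (F := fun x => -F x) hF.neg (a := -a) (fun x ξ => by
    rw [hfd, fderiv_fun_neg]
    simpa using hup x ξ) x y
  rw [inner_gradient_left, hfd] at this
  rw [inner_gradient_left]
  simp only [neg_apply] at this
  linarith

end Convex

/-! ### Structural properties of the data. -/

namespace ControlProblem

variable {H U : Type*}
  [NormedAddCommGroup H] [InnerProductSpace ℝ H] [CompleteSpace H]
  [NormedAddCommGroup U] [InnerProductSpace ℝ U] [CompleteSpace U]

/-- A smooth payoff with zero gradient at the origin whose Hessian lies between `a` and `M`. -/
structure IsConvexPayoff (F : H → ℝ) (a M : ℝ) : Prop where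
  low_pos : 0 < a
  up_pos : 0 < M
  hasGradientAt : ∀ x, HasGradientAt F (gradient F x) x
  gradient_zero : gradient F 0 = 0
  norm_gradient_sub_le : ∀ x y, ‖gradient F x - gradient F y‖ ≤ M * ‖x - y‖
  lower : ∀ x y, F x + inner ℝ (gradient F x) (y - x) + a / 2 * ‖y - x‖ ^ 2 ≤ F y
  upper : ∀ x y, F y ≤ F x + inner ℝ (gradient F x) (y - x) + M / 2 * ‖y - x‖ ^ 2

namespace IsConvexPayoff

variable {F : H → ℝ} {a M : ℝ}

theorem of_hessian [Nontrivial H] (hF : ContDiff ℝ 2 F) (h0 : gradient F 0 = 0) (ha : 0 < a)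
    (hlow : ∀ x ξ : H, a * ‖ξ‖ ^ 2 ≤ fderiv ℝ (fderiv ℝ F) x ξ ξ)
    (hup : ∀ x ξ : H, fderiv ℝ (fderiv ℝ F) x ξ ξ ≤ M * ‖ξ‖ ^ 2) : IsConvexPayoff F a M := by
  obtain ⟨ξ, hξ⟩ := exists_ne (0 : H)
  have hM : 0 < M := by
    have h1 := (hlow 0 ξ).trans (hup 0 ξ)
    have h2 : 0 < ‖ξ‖ ^ 2 := by positivity
    exact ha.trans_le (le_of_mul_le_mul_right h1 h2)
  exact ⟨ha, hM, fun x => (hF.differentiable (by norm_num) x).hasGradientAt, h0,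
    norm_gradient_sub_le_of_hessian_le hF ha.le hM.le hlow hup, le_of_hessian_ge hF hlow,
    le_of_hessian_le hF hup⟩

theorem norm_gradient_le (h : IsConvexPayoff F a M) (x : H) : ‖gradient F x‖ ≤ M * ‖x‖ := by
  simpa [h.gradient_zero] using h.norm_gradient_sub_le x 0

theorem inner_gradient_sub_ge (h : IsConvexPayoff F a M) (x y : H) :
    a * ‖x - y‖ ^ 2 ≤ inner ℝ (gradient F x - gradient F y) (x - y) := by
  have h1 := h.lower x y
  have h2 := h.lower y x
  rw [norm_sub_rev] at h1
  rw [← neg_sub x y, inner_neg_right] at h1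
  rw [inner_sub_left]
  linarith

theorem continuous (h : IsConvexPayoff F a M) : Continuous F :=
  continuous_iff_continuousAt.2 fun x => (h.hasGradientAt x).hasFDerivAt.continuousAt

theorem continuous_gradient (h : IsConvexPayoff F a M) : Continuous (gradient F) :=
  (LipschitzWith.of_dist_le_mul (K := ⟨M, h.up_pos.le⟩) fun x y => by
    rw [dist_eq_norm, dist_eq_norm]
    exact h.norm_gradient_sub_le x y).continuous

end IsConvexPayoff

/-- The structural properties of the control problem from which everything is derived. -/
structure Regular (P : ControlProblem H U) (γ b ν M νT MT m : ℝ) : Prop where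
  T_pos : 0 < P.T
  γ_nonneg : 0 ≤ γ
  b_nonneg : 0 ≤ b
  m_pos : 0 < m
  A_zero : P.A 0 = 0
  differentiable_A : Differentiable ℝ P.A
  norm_fderiv_le : ∀ x, ‖fderiv ℝ P.A x‖ ≤ γ
  norm_fderiv_sub_le : ∀ x₁ x₂ : H,
    ‖fderiv ℝ P.A x₁ - fderiv ℝ P.A x₂‖ ≤ b * ‖x₁ - x₂‖ / (1 + max ‖x₁‖ ‖x₂‖)
  running : IsConvexPayoff P.F ν M
  terminal : IsConvexPayoff P.FT νT MT
  N_symm : ∀ u v : U, inner ℝ (P.N u) v = inner ℝ u (P.N v)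
  N_nonneg : ∀ v : U, 0 ≤ inner ℝ v (P.N v)
  K_ge : ∀ ξ : H, m * ‖ξ‖ ^ 2 ≤ inner ℝ (P.K ξ) ξ

namespace Regular

variable {P : ControlProblem H U} {γ b ν M νT MT m : ℝ}

theorem norm_A_sub_le (h : P.Regular γ b ν M νT MT m) (x y : H) :
    ‖P.A x - P.A y‖ ≤ γ * ‖x - y‖ :=
  convex_univ.norm_image_sub_le_of_norm_fderiv_le (𝕜 := ℝ) (fun z _ => h.differentiable_A z)
    (fun z _ => h.norm_fderiv_le z) (mem_univ y) (mem_univ x)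

theorem norm_A_le (h : P.Regular γ b ν M νT MT m) (x : H) : ‖P.A x‖ ≤ γ * ‖x‖ := by
  simpa [h.A_zero] using h.norm_A_sub_le x 0

/-- The weight is kept at one base point only, the one where a bound `‖p‖ ≤ α‖y‖` will be available;
there `‖p‖ / (1 + ‖y‖) ≤ α`. -/
theorem norm_fderiv_sub_mul_le (h : P.Regular γ b ν M νT MT m) (x y : H) :
    ‖fderiv ℝ P.A x - fderiv ℝ P.A y‖ ≤ b / (1 + ‖y‖) * ‖x - y‖ := by
  refine (h.norm_fderiv_sub_le x y).trans ?_
  rw [div_mul_eq_mul_div]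
  have := h.b_nonneg
  gcongr
  exact le_max_right _ _

theorem norm_fderiv_sub_le_mul (h : P.Regular γ b ν M νT MT m) (x y : H) :
    ‖fderiv ℝ P.A x - fderiv ℝ P.A y‖ ≤ b * ‖x - y‖ := by
  refine (h.norm_fderiv_sub_mul_le x y).trans ?_
  have := h.b_nonneg
  gcongr
  exact div_le_self this (by linarith [norm_nonneg y])

theorem continuous_fderiv (h : P.Regular γ b ν M νT MT m) : Continuous (fderiv ℝ P.A) :=
  (LipschitzWith.of_dist_le_mul (K := ⟨b, h.b_nonneg⟩) fun x y => by
    rw [dist_eq_norm, dist_eq_norm]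
    exact h.norm_fderiv_sub_le_mul x y).continuous

theorem norm_A_sub_sub_le (h : P.Regular γ b ν M νT MT m) (x y : H) :
    ‖P.A y - P.A x - fderiv ℝ P.A x (y - x)‖ ≤ b / (1 + ‖x‖) / 2 * ‖y - x‖ ^ 2 := by
  refine norm_sub_sub_le_of_norm_fderiv_sub_le h.differentiable_A x y fun θ hθ => ?_
  refine (h.norm_fderiv_sub_mul_le _ x).trans (le_of_eq ?_)
  rw [add_sub_cancel_left, norm_smul, Real.norm_of_nonneg hθ.1]

/-- The second-order remainder of the drift, paired with a covector of linear growth. -/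
theorem abs_inner_remainder_le (h : P.Regular γ b ν M νT MT m) {α : ℝ} {x p : H}
    (hp : ‖p‖ ≤ α * ‖x‖) (hα : 0 ≤ α) (y : H) :
    |inner ℝ p (P.A y - P.A x - fderiv ℝ P.A x (y - x))| ≤ b * α / 2 * ‖y - x‖ ^ 2 := by
  refine (abs_real_inner_le_norm _ _).trans ?_
  have hb := h.b_nonneg
  calc ‖p‖ * ‖P.A y - P.A x - fderiv ℝ P.A x (y - x)‖
      ≤ (α * ‖x‖) * (b / (1 + ‖x‖) / 2 * ‖y - x‖ ^ 2) :=
        mul_le_mul hp (h.norm_A_sub_sub_le x y) (norm_nonneg _) (by positivity)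
    _ = b * α / 2 * ‖y - x‖ ^ 2 * (‖x‖ / (1 + ‖x‖)) := by ring
    _ ≤ b * α / 2 * ‖y - x‖ ^ 2 * 1 := by
        gcongr
        rw [div_le_one (by positivity)]
        linarith
    _ = _ := mul_one _

theorem N_symm_symm (h : P.Regular γ b ν M νT MT m) (u v : U) :
    (inner ℝ (P.N.symm u) v : ℝ) = inner ℝ u (P.N.symm v) := by
  have := h.N_symm (P.N.symm u) (P.N.symm v)
  rw [ContinuousLinearEquiv.apply_symm_apply, ContinuousLinearEquiv.apply_symm_apply] at this
  exact this.symm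

theorem K_symm (h : P.Regular γ b ν M νT MT m) (x y : H) :
    (inner ℝ (P.K x) y : ℝ) = inner ℝ x (P.K y) := by
  simp only [K, ContinuousLinearMap.comp_apply, ContinuousLinearEquiv.coe_coe]
  rw [← ContinuousLinearMap.adjoint_inner_right, h.N_symm_symm,
    ContinuousLinearMap.adjoint_inner_left]

/-- Lax–Milgram for the coercive form of `K`. A right inverse means that every change of velocity
can be produced by a change of `q` in `A(y) - K q`. -/
theorem exists_K_inverse (h : P.Regular γ b ν M νT MT m) :
    ∃ L : H →L[ℝ] H, ∀ x, P.K (L x) = x := by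
  have hco : IsCoercive (innerSL ℝ ∘L P.K) := ⟨m, h.m_pos, fun u => by
    have := h.K_ge u
    rw [pow_two, ← mul_assoc] at this
    exact this⟩
  refine ⟨hco.continuousLinearEquivOfBilin.symm, fun x => ?_⟩
  set z := hco.continuousLinearEquivOfBilin.symm x with hz
  have : ∀ w, (inner ℝ (P.K z) w : ℝ) = inner ℝ x w := fun w => by
    have h1 := hco.continuousLinearEquivOfBilin_apply z w
    rw [hz, ContinuousLinearEquiv.apply_symm_apply] at h1
    rw [h1]
    rfl
  exact ext_inner_right ℝ this

end Regular

end ControlProblem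

/-! ### The Hamiltonian system, its a priori estimates, and extremals through every point. -/

theorem mul_mul_le_add_sq {a c d X Y : ℝ} (ha : 0 < a) (hd : d ^ 2 ≤ 4 * a * c) :
    d * X * Y ≤ a * X ^ 2 + c * Y ^ 2 := by
  have h1 : 0 ≤ 4 * a * (a * X ^ 2 + c * Y ^ 2 - d * X * Y) := by
    have : 4 * a * (a * X ^ 2 + c * Y ^ 2 - d * X * Y)
        = (2 * a * X - d * Y) ^ 2 + (4 * a * c - d ^ 2) * Y ^ 2 := by ring
    rw [this]
    have : 0 ≤ 4 * a * c - d ^ 2 := by linarith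
    positivity
  have := nonneg_of_mul_nonneg_right h1 (by linarith)
  linarith

namespace ControlProblem

variable {H U : Type*}
  [NormedAddCommGroup H] [InnerProductSpace ℝ H] [CompleteSpace H]
  [NormedAddCommGroup U] [InnerProductSpace ℝ U] [CompleteSpace U]

/-- The Hamiltonian vector field of the maximum principle. -/
noncomputable def hamiltonianField (P : ControlProblem H U) (w : H × H) : H × H :=
  (P.A w.1 - P.K w.2,
    -(ContinuousLinearMap.adjoint (fderiv ℝ P.A w.1) w.2 + gradient P.F w.1))

/-- State and adjoint state solve the Hamiltonian system in a neighbourhood of `[0, T]`. -/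
structure IsHamiltonianCurve (P : ControlProblem H U) (x p : ℝ → H) : Prop where
  state : ∀ s ∈ Ioo (-1) (P.T + 1), HasDerivAt x (P.A (x s) - P.K (p s)) s
  adjoint : ∀ s ∈ Ioo (-1) (P.T + 1), HasDerivAt p
    (-(ContinuousLinearMap.adjoint (fderiv ℝ P.A (x s)) (p s) + gradient P.F (x s))) s

/-- A Hamiltonian curve that satisfies the transversality condition at the final time. -/
structure IsExtremal (P : ControlProblem H U) (x p : ℝ → H) : Prop
    extends P.IsHamiltonianCurve x p where
  transversality : p P.T = gradient P.FT (x P.T)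

/-- The margin on both sides lets Hamiltonian curves have two-sided derivatives at `0` and `T`. -/
theorem Icc_subset_Ioo_time (P : ControlProblem H U) : Icc 0 P.T ⊆ Ioo (-1) (P.T + 1) :=
  fun s hs => ⟨by linarith [hs.1], by linarith [hs.2]⟩

theorem IsHamiltonianCurve.continuousOn_state {P : ControlProblem H U} {x p : ℝ → H}
    (h : P.IsHamiltonianCurve x p) : ContinuousOn x (Ioo (-1) (P.T + 1)) :=
  fun s hs => (h.state s hs).continuousAt.continuousWithinAt

theorem IsHamiltonianCurve.continuousOn_adjoint {P : ControlProblem H U} {x p : ℝ → H}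
    (h : P.IsHamiltonianCurve x p) : ContinuousOn p (Ioo (-1) (P.T + 1)) :=
  fun s hs => (h.adjoint s hs).continuousAt.continuousWithinAt

namespace Regular

variable {P : ControlProblem H U} {γ b ν M νT MT m : ℝ}

theorem norm_adjoint_le (h : P.Regular γ b ν M νT MT m) (x p : H) :
    ‖ContinuousLinearMap.adjoint (fderiv ℝ P.A x) p‖ ≤ γ * ‖p‖ := by
  refine (ContinuousLinearMap.le_opNorm _ _).trans ?_
  rw [LinearIsometryEquiv.norm_map]
  gcongr
  exact h.norm_fderiv_le x

theorem norm_adjoint_sub_le (h : P.Regular γ b ν M νT MT m) (x y p q : H) :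
    ‖ContinuousLinearMap.adjoint (fderiv ℝ P.A x) p
      - ContinuousLinearMap.adjoint (fderiv ℝ P.A y) q‖
      ≤ γ * ‖p - q‖ + b / (1 + ‖y‖) * ‖x - y‖ * ‖q‖ := by
  have e : ContinuousLinearMap.adjoint (fderiv ℝ P.A x) p
      - ContinuousLinearMap.adjoint (fderiv ℝ P.A y) q
      = ContinuousLinearMap.adjoint (fderiv ℝ P.A x) (p - q)
        + ContinuousLinearMap.adjoint (fderiv ℝ P.A x - fderiv ℝ P.A y) q := by
    simp only [map_sub, sub_apply]
    abel
  rw [e]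
  refine (norm_add_le _ _).trans (add_le_add (h.norm_adjoint_le x _) ?_)
  refine (ContinuousLinearMap.le_opNorm _ _).trans ?_
  rw [LinearIsometryEquiv.norm_map]
  gcongr
  exact h.norm_fderiv_sub_mul_le x y

theorem norm_hamiltonianField_le (h : P.Regular γ b ν M νT MT m) (w : H × H) :
    ‖P.hamiltonianField w‖ ≤ (γ + ‖P.K‖ + M) * ‖w‖ := by
  have h1 := norm_fst_le w
  have h2 := norm_snd_le w
  have hM := h.running.up_pos
  have hγ := h.γ_nonneg
  refine norm_prod_le_iff.2 ⟨?_, ?_⟩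
  · refine (norm_sub_le _ _).trans ?_
    have h3 : ‖P.A w.1‖ ≤ γ * ‖w‖ := (h.norm_A_le _).trans (by gcongr)
    have h4 : ‖P.K w.2‖ ≤ ‖P.K‖ * ‖w‖ := (P.K.le_opNorm _).trans (by gcongr)
    have : 0 ≤ M * ‖w‖ := by positivity
    linarith
  · simp only [hamiltonianField, norm_neg]
    refine (norm_add_le _ _).trans ?_
    have h3 := (h.norm_adjoint_le w.1 w.2).trans (show γ * ‖w.2‖ ≤ γ * ‖w‖ by gcongr)
    have h4 := (h.running.norm_gradient_le w.1).trans (show M * ‖w.1‖ ≤ M * ‖w‖ by gcongr)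
    have : 0 ≤ ‖P.K‖ * ‖w‖ := by positivity
    linarith

/-- The restriction to balls comes from `DA(x)* p`, a product: varying `x` costs a factor `‖p‖`,
bounded here by `|R|`. -/
theorem lipschitzOnWith_hamiltonianField (h : P.Regular γ b ν M νT MT m) (R : ℝ) :
    ∃ L : NNReal, LipschitzOnWith L P.hamiltonianField (Metric.closedBall 0 R) := by
  have hM := h.running.up_pos
  have hγ := h.γ_nonneg
  have hb := h.b_nonneg
  refine ⟨⟨γ + ‖P.K‖ + M + b * |R|, by positivity⟩, LipschitzOnWith.of_dist_le_mul ?_⟩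
  intro w hw z hz
  rw [dist_eq_norm, dist_eq_norm]
  change _ ≤ (γ + ‖P.K‖ + M + b * |R|) * ‖w - z‖
  have h1 : ‖w.1 - z.1‖ ≤ ‖w - z‖ := norm_fst_le (w - z)
  have h2 : ‖w.2 - z.2‖ ≤ ‖w - z‖ := norm_snd_le (w - z)
  have hz2 : ‖z.2‖ ≤ |R| :=
    (norm_snd_le z).trans ((mem_closedBall_zero_iff.1 hz).trans (le_abs_self R))
  refine norm_prod_le_iff.2 ⟨?_, ?_⟩
  · have e : (P.hamiltonianField w - P.hamiltonianField z).1
        = (P.A w.1 - P.A z.1) - P.K (w.2 - z.2) := by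
      simp only [hamiltonianField, Prod.fst_sub, map_sub]
      abel
    rw [e]
    refine (norm_sub_le _ _).trans ?_
    have h3 := (h.norm_A_sub_le w.1 z.1).trans (show _ ≤ γ * ‖w - z‖ by gcongr)
    have h4 := (P.K.le_opNorm (w.2 - z.2)).trans (show _ ≤ ‖P.K‖ * ‖w - z‖ by gcongr)
    have : 0 ≤ (M + b * |R|) * ‖w - z‖ := by positivity
    linarith
  · have e : (P.hamiltonianField w - P.hamiltonianField z).2
        = -((ContinuousLinearMap.adjoint (fderiv ℝ P.A w.1) w.2
          - ContinuousLinearMap.adjoint (fderiv ℝ P.A z.1) z.2)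
          + (gradient P.F w.1 - gradient P.F z.1)) := by
      simp only [hamiltonianField, Prod.snd_sub]
      abel
    rw [e, norm_neg]
    refine (norm_add_le _ _).trans ?_
    have h3 := h.norm_adjoint_sub_le w.1 z.1 w.2 z.2
    have h4 := (h.running.norm_gradient_sub_le w.1 z.1).trans (show _ ≤ M * ‖w - z‖ by gcongr)
    have h5 : b / (1 + ‖z.1‖) * ‖w.1 - z.1‖ * ‖z.2‖ ≤ b * ‖w - z‖ * |R| := by
      gcongr
      exact div_le_self hb (by linarith [norm_nonneg z.1])
    have h6 : γ * ‖w.2 - z.2‖ ≤ γ * ‖w - z‖ := by gcongr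
    have : 0 ≤ ‖P.K‖ * ‖w - z‖ := by positivity
    linarith

theorem exists_isHamiltonianCurve (h : P.Regular γ b ν M νT MT m) {t : ℝ} (ht : t ∈ Icc 0 P.T)
    (x₀ p₀ : H) : ∃ x p, P.IsHamiltonianCurve x p ∧ x t = x₀ ∧ p t = p₀ := by
  obtain ⟨w, hw0, hw⟩ := exists_hasDerivAt_of_linear_growth h.lipschitzOnWith_hamiltonianField
    h.norm_hamiltonianField_le (-1) (P.T + 1) t (Ioo_subset_Icc_self (P.Icc_subset_Ioo_time ht))
    (x₀, p₀)
  refine ⟨fun s => (w s).1, fun s => (w s).2, ⟨fun s hs => ?_, fun s hs => ?_⟩, ?_, ?_⟩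
  · exact (hw s hs).fst
  · exact (hw s hs).snd
  · simp only [hw0]
  · simp only [hw0]

theorem inner_neg_adjoint_add_gradient (x p y f : H) :
    (inner ℝ (-(ContinuousLinearMap.adjoint (fderiv ℝ P.A x) p + f)) y : ℝ)
      = -inner ℝ p (fderiv ℝ P.A x y) - inner ℝ f y := by
  rw [inner_neg_left, inner_add_left, ContinuousLinearMap.adjoint_inner_left]
  ring

/-- Since `(p, x)' = -(Kp, p) - (DF(x), x) + (p, A(x) - DA(x)x)`, only the last term can spoil
dissipation. As `A(0) = 0`, it is a Taylor remainder from `x` to `0`, at most `b/2 · ‖p‖‖x‖` thanks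
to the weight. -/
theorem norm_adjoint_le_mul_norm_state (h : P.Regular γ b ν M νT MT m) {k : ℝ} (hk : 0 < k)
    (hkm : k < m) (hb : b ^ 2 / 16 < (m - k) * (ν - k)) {x p : ℝ → H} (he : P.IsExtremal x p)
    {s : ℝ} (hs : s ∈ Icc 0 P.T) :
    ‖p s‖ ≤ (MT ^ 2 / νT + (γ ^ 2 + M ^ 2) / k * P.T) * ‖x s‖ := by
  have hsub : Icc s P.T ⊆ Ioo (-1) (P.T + 1) :=
    (Icc_subset_Icc_left hs.1).trans P.Icc_subset_Ioo_time
  refine (norm_le_mul_norm_of_inner_dissipation hs.2 (by linarith [hs.1]) hk h.terminal.low_pos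
    h.terminal.up_pos (fun r hr => he.state r (hsub hr)) (fun r hr => he.adjoint r (hsub hr))
    (fun r _ => ?_) (fun r _ => ?_) ?_ ?_).2
  · rw [inner_neg_adjoint_add_gradient, inner_sub_right]
    have h1 := h.norm_A_sub_sub_le (x r) 0
    rw [h.A_zero, zero_sub, zero_sub, map_neg, norm_neg, sub_neg_eq_add] at h1
    have hb0 := h.b_nonneg
    have h2 : b / (1 + ‖x r‖) / 2 * ‖x r‖ ^ 2 ≤ b / 2 * ‖x r‖ := by
      have : b / (1 + ‖x r‖) / 2 * ‖x r‖ ^ 2 = b / 2 * ‖x r‖ * (‖x r‖ / (1 + ‖x r‖)) := by ring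
      rw [this]
      refine mul_le_of_le_one_right (by positivity) ?_
      rw [div_le_one (by positivity)]
      linarith
    have h3 : (inner ℝ (p r) (P.A (x r)) : ℝ) - inner ℝ (p r) (fderiv ℝ P.A (x r) (x r))
        ≤ b / 2 * ‖p r‖ * ‖x r‖ := by
      rw [← inner_sub_right]
      refine (real_inner_le_norm _ _).trans ?_
      have h4 : ‖P.A (x r) - fderiv ℝ P.A (x r) (x r)‖ ≤ b / 2 * ‖x r‖ := by
        refine le_trans (le_of_eq ?_) (h1.trans h2)
        rw [← norm_neg]
        congr 1
        abel
      calc _ ≤ ‖p r‖ * (b / 2 * ‖x r‖) := by gcongr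
        _ = _ := by ring
    -- For the coefficient `b/2` the discriminant condition is `b²/4 ≤ 4(m - k)(ν - k)`, the origin
    -- of `b²/16`.
    have h5 := mul_mul_le_add_sq (a := m - k) (c := ν - k) (d := b / 2) (X := ‖p r‖) (Y := ‖x r‖)
      (by linarith) (by nlinarith)
    have h6 := h.K_ge (p r)
    have h7 := h.running.inner_gradient_sub_ge (x r) 0
    rw [h.running.gradient_zero, sub_zero, sub_zero] at h7
    rw [real_inner_comm (P.K (p r)) (p r)]
    linarith
  · rw [norm_neg]
    exact (norm_add_le _ _).trans
      (add_le_add (h.norm_adjoint_le _ _) (h.running.norm_gradient_le _))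
  · have := h.terminal.inner_gradient_sub_ge (x P.T) 0
    rw [he.transversality]
    simpa [h.terminal.gradient_zero] using this
  · rw [he.transversality]
    exact h.terminal.norm_gradient_le _

end Regular

/-- A regular control problem whose extremals satisfy the linear a priori bound `‖p‖ ≤ α ‖x‖` with
`b α < ν`. -/
structure Controlled (P : ControlProblem H U) (γ b ν M νT MT m α : ℝ) : Prop
    extends P.Regular γ b ν M νT MT m where
  α_nonneg : 0 ≤ α
  b_mul_lt : b * α < ν
  apriori : ∀ x p : ℝ → H, P.IsExtremal x p → ∀ s ∈ Icc 0 P.T, ‖p s‖ ≤ α * ‖x s‖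

namespace Controlled

variable {P : ControlProblem H U} {γ b ν M νT MT m α : ℝ}

/-- The dissipation argument for the difference of two extremals. The coercivity left after the
drift remainders are absorbed is the minimum of `m` and `ν - bα`. -/
theorem exists_norm_adjoint_sub_le (h : P.Controlled γ b ν M νT MT m α) :
    ∃ β : ℝ, 0 ≤ β ∧ ∀ x₁ p₁ x₂ p₂ : ℝ → H, P.IsExtremal x₁ p₁ → P.IsExtremal x₂ p₂ →
      ∀ s ∈ Icc 0 P.T, ‖p₁ s - p₂ s‖ ≤ β * ‖x₁ s - x₂ s‖ := by
  set κ := min m (ν - b * α) with hκ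
  have hκpos : 0 < κ := lt_min h.m_pos (by linarith [h.b_mul_lt])
  have hT := h.T_pos
  have hνT := h.terminal.low_pos
  have hb := h.b_nonneg
  have hα := h.α_nonneg
  refine ⟨MT ^ 2 / νT + (γ ^ 2 + (M + b * α) ^ 2) / κ * P.T, by positivity, ?_⟩
  intro x₁ p₁ x₂ p₂ h₁ h₂ s hs
  have hsub : Icc s P.T ⊆ Icc 0 P.T := Icc_subset_Icc_left hs.1
  have hsub' : Icc s P.T ⊆ Ioo (-1) (P.T + 1) := hsub.trans P.Icc_subset_Ioo_time
  refine (norm_le_mul_norm_of_inner_dissipation (x := fun r => x₁ r - x₂ r)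
    (p := fun r => p₁ r - p₂ r) hs.2 (by linarith [hs.1]) hκpos hνT h.terminal.up_pos
    (fun r hr => (h₁.state r (hsub' hr)).fun_sub (h₂.state r (hsub' hr)))
    (fun r hr => (h₁.adjoint r (hsub' hr)).fun_sub (h₂.adjoint r (hsub' hr)))
    (fun r hr => ?_) (fun r hr => ?_) ?_ ?_).2
  -- The drift terms regroup into two Taylor remainders, from `x₁` to `x₂` paired with `p₁` and from
  -- `x₂` to `x₁` paired with `p₂`. Each costs `bα/2`.
  · have r1 := abs_le.1 (h.abs_inner_remainder_le (h.apriori _ _ h₁ r (hsub hr)) hα (x₂ r))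
    have r2 := abs_le.1 (h.abs_inner_remainder_le (h.apriori _ _ h₂ r (hsub hr)) hα (x₁ r))
    have h6 := h.K_ge (p₁ r - p₂ r)
    have h7 := h.running.inner_gradient_sub_ge (x₁ r) (x₂ r)
    rw [norm_sub_rev (x₂ r)] at r1
    have hm1 : κ * ‖p₁ r - p₂ r‖ ^ 2 ≤ m * ‖p₁ r - p₂ r‖ ^ 2 := by
      gcongr
      exact min_le_left _ _
    have hm2 : κ * ‖x₁ r - x₂ r‖ ^ 2 ≤ (ν - b * α) * ‖x₁ r - x₂ r‖ ^ 2 := by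
      gcongr
      exact min_le_right _ _
    rw [real_inner_comm] at h6
    rw [inner_sub_left (-_), Regular.inner_neg_adjoint_add_gradient,
      Regular.inner_neg_adjoint_add_gradient]
    simp only [inner_sub_left, inner_sub_right, map_sub] at r1 r2 h6 h7 ⊢
    linarith [r1.1, r2.1]
  · have e : -(ContinuousLinearMap.adjoint (fderiv ℝ P.A (x₁ r)) (p₁ r) + gradient P.F (x₁ r))
        - -(ContinuousLinearMap.adjoint (fderiv ℝ P.A (x₂ r)) (p₂ r) + gradient P.F (x₂ r))
        = -((ContinuousLinearMap.adjoint (fderiv ℝ P.A (x₁ r)) (p₁ r)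
          - ContinuousLinearMap.adjoint (fderiv ℝ P.A (x₂ r)) (p₂ r))
          + (gradient P.F (x₁ r) - gradient P.F (x₂ r))) := by abel
    rw [e, norm_neg]
    refine (norm_add_le _ _).trans ?_
    have h3 := h.norm_adjoint_sub_le (x₁ r) (x₂ r) (p₁ r) (p₂ r)
    have h4 := h.running.norm_gradient_sub_le (x₁ r) (x₂ r)
    have h5 : b / (1 + ‖x₂ r‖) * ‖x₁ r - x₂ r‖ * ‖p₂ r‖ ≤ b * α * ‖x₁ r - x₂ r‖ := by
      calc b / (1 + ‖x₂ r‖) * ‖x₁ r - x₂ r‖ * ‖p₂ r‖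
          ≤ b / (1 + ‖x₂ r‖) * ‖x₁ r - x₂ r‖ * (α * ‖x₂ r‖) := by
            gcongr
            exact h.apriori _ _ h₂ r (hsub hr)
        _ = b * α * ‖x₁ r - x₂ r‖ * (‖x₂ r‖ / (1 + ‖x₂ r‖)) := by ring
        _ ≤ b * α * ‖x₁ r - x₂ r‖ := by
            refine mul_le_of_le_one_right (by positivity) ?_
            rw [div_le_one (by positivity)]
            linarith
    linarith
  · rw [h₁.transversality, h₂.transversality]
    exact h.terminal.inner_gradient_sub_ge _ _
  · rw [h₁.transversality, h₂.transversality]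
    exact h.terminal.norm_gradient_sub_le _ _

/-- Lipschitz dependence of `p` on `x` closes the state equation, and Grönwall applies. The second
estimate says that the flow of extremal states from time `r` to `s` differs from the identity by a
map of Lipschitz constant `C|s - r|`. -/
theorem exists_norm_state_sub_le (h : P.Controlled γ b ν M νT MT m α) :
    ∃ C E : ℝ, 0 ≤ C ∧ 0 ≤ E ∧ ∀ x₁ p₁ x₂ p₂ : ℝ → H, P.IsExtremal x₁ p₁ → P.IsExtremal x₂ p₂ →
      ∀ s ∈ Icc 0 P.T, ∀ r ∈ Icc 0 P.T, ‖x₁ s - x₂ s‖ ≤ E * ‖x₁ r - x₂ r‖ ∧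
        ‖(x₁ s - x₂ s) - (x₁ r - x₂ r)‖ ≤ C * ‖x₁ r - x₂ r‖ * |s - r| := by
  obtain ⟨β, hβ, hp⟩ := h.exists_norm_adjoint_sub_le
  set c := γ + ‖P.K‖ * β with hc
  have hγ := h.γ_nonneg
  have hc0 : 0 ≤ c := by positivity
  refine ⟨c * Real.exp (c * P.T), Real.exp (c * P.T), by positivity, by positivity, ?_⟩
  intro x₁ p₁ x₂ p₂ h₁ h₂ s hs r hr
  have hd : ∀ u ∈ Icc 0 P.T, HasDerivWithinAt (fun u => x₁ u - x₂ u)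
      (P.A (x₁ u) - P.K (p₁ u) - (P.A (x₂ u) - P.K (p₂ u))) (Icc 0 P.T) u := fun u hu =>
    ((h₁.state u (P.Icc_subset_Ioo_time hu)).fun_sub
      (h₂.state u (P.Icc_subset_Ioo_time hu))).hasDerivWithinAt
  have hbd : ∀ u ∈ Icc 0 P.T,
      ‖P.A (x₁ u) - P.K (p₁ u) - (P.A (x₂ u) - P.K (p₂ u))‖ ≤ c * ‖x₁ u - x₂ u‖ := by
    intro u hu
    have e : P.A (x₁ u) - P.K (p₁ u) - (P.A (x₂ u) - P.K (p₂ u))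
        = (P.A (x₁ u) - P.A (x₂ u)) - P.K (p₁ u - p₂ u) := by
      rw [map_sub]
      abel
    rw [e]
    refine (norm_sub_le _ _).trans ?_
    have h3 := h.norm_A_sub_le (x₁ u) (x₂ u)
    have h4 : ‖P.K (p₁ u - p₂ u)‖ ≤ ‖P.K‖ * (β * ‖x₁ u - x₂ u‖) :=
      (P.K.le_opNorm _).trans (by
        gcongr
        exact hp _ _ _ _ h₁ h₂ u hu)
    rw [hc]
    linarith
  have hexp : ∀ u ∈ Icc 0 P.T, ‖x₁ u - x₂ u‖ ≤ Real.exp (c * P.T) * ‖x₁ r - x₂ r‖ := by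
    intro u hu
    refine (norm_le_exp_mul_norm_of_norm_deriv_le hd hbd u hu r hr).trans ?_
    gcongr
    rw [abs_le]
    constructor <;> linarith [hu.1, hu.2, hr.1, hr.2]
  refine ⟨hexp s hs, ?_⟩
  have := (convex_Icc 0 P.T).norm_image_sub_le_of_norm_hasDerivWithin_le hd
    (C := c * Real.exp (c * P.T) * ‖x₁ r - x₂ r‖)
    (fun u hu => (hbd u hu).trans (by
      rw [mul_assoc]
      exact mul_le_mul_of_nonneg_left (hexp u hu) hc0)) hr hs
  simpa using this

/-- Through every point passes an extremal. -/
theorem exists_isExtremal (h : P.Controlled γ b ν M νT MT m α) (x₀ : H) {t : ℝ}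
    (ht : t ∈ Icc 0 P.T) : ∃ x p, P.IsExtremal x p ∧ x t = x₀ := by
  have hT : P.T ∈ Icc 0 P.T := right_mem_Icc.2 h.T_pos.le
  have hex : ∀ z : H, ∃ x p, P.IsExtremal x p ∧ x P.T = z := fun z => by
    obtain ⟨x, p, hxp, hx, hp⟩ := h.exists_isHamiltonianCurve hT z (gradient P.FT z)
    exact ⟨x, p, ⟨hxp, by rw [hp, hx]⟩, hx⟩
  obtain ⟨C, E, hC, hE, hbd⟩ := h.exists_norm_state_sub_le
  set S : ℝ → Prop := fun t => ∀ x₀ : H, ∃ x p, P.IsExtremal x p ∧ x t = x₀ with hS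
  -- The map sending the state `w` at time `t` to the state at time `s` is a contractive
  -- perturbation of the identity, hence onto: the required `w` is the fixed point of `w ↦ x₀ -
  -- (x_w(s) - w)`.
  have step : ∀ t ∈ Icc 0 P.T, ∀ s ∈ Icc 0 P.T, C * |s - t| ≤ 1 / 2 → S t → S s := by
    intro t ht s hs hst hSt x₀
    choose x p hxp hx using hSt
    have hcon : ContractingWith (1 / 2) fun w => x₀ - (x w s - w) := by
      refine ⟨by norm_num, LipschitzWith.of_dist_le_mul fun w z => ?_⟩
      have h1 := (hbd _ _ _ _ (hxp w) (hxp z) s hs t ht).2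
      rw [hx, hx] at h1
      rw [dist_eq_norm, dist_eq_norm]
      have e : x₀ - (x w s - w) - (x₀ - (x z s - z)) = -(x w s - x z s - (w - z)) := by abel
      rw [e, norm_neg]
      refine h1.trans ?_
      push_cast
      calc C * ‖w - z‖ * |s - t| = C * |s - t| * ‖w - z‖ := by ring
        _ ≤ 1 / 2 * ‖w - z‖ := by gcongr
    have hfix := hcon.fixedPoint_isFixedPt
    set w := hcon.fixedPoint with hw
    refine ⟨x w, p w, hxp w, ?_⟩
    have h2 : x₀ - (x w s - w) = w := hfix
    have h3 : x₀ - x w s = 0 := by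
      rw [← sub_eq_zero] at h2
      rw [← h2]
      abel
    exact (sub_eq_zero.1 h3).symm
  -- `C` does not depend on time, so one step length serves throughout and finitely many steps back
  -- from `T` reach `t`.
  set δ : ℝ := 1 / (2 * (C + 1)) with hδ
  have hδpos : 0 < δ := by positivity
  have hCδ : C * δ ≤ 1 / 2 := by
    rw [hδ, mul_one_div, div_le_div_iff₀ (by positivity) (by norm_num)]
    linarith
  have hind : ∀ n : ℕ, ∀ t ∈ Icc 0 P.T, P.T - t ≤ n * δ → S t := by
    intro n
    induction n with
    | zero =>
      intro t ht hle
      have : t = P.T := le_antisymm ht.2 (by simpa using hle)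
      exact this ▸ hex
    | succ n ih =>
      intro t ht hle
      push_cast at hle
      have hmem : min P.T (t + δ) ∈ Icc 0 P.T :=
        ⟨le_min h.T_pos.le (by linarith [ht.1]), min_le_left _ _⟩
      refine step (min P.T (t + δ)) hmem t ht ?_ (ih _ hmem ?_)
      · have h1 : |t - min P.T (t + δ)| ≤ δ := by
          rw [abs_sub_comm, abs_of_nonneg (by
            have := le_min ht.2 (show t ≤ t + δ by linarith)
            linarith)]
          linarith [min_le_right P.T (t + δ)]
        exact (mul_le_mul_of_nonneg_left h1 hC).trans hCδ
      · rcases min_choice P.T (t + δ) with h1 | h1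
        · rw [h1, sub_self]
          positivity
        · rw [h1]
          linarith
  obtain ⟨n, hn⟩ := exists_nat_ge ((P.T - t) / δ)
  exact hind n t ht ((div_le_iff₀ hδpos).1 hn) x₀

end Controlled

end ControlProblem

/-! ### Optimality of extremals and formulas for the value function. -/

namespace ControlProblem

variable {H U : Type*}
  [NormedAddCommGroup H] [InnerProductSpace ℝ H] [CompleteSpace H]
  [NormedAddCommGroup U] [InnerProductSpace ℝ U] [CompleteSpace U]

/-- The control `-N⁻¹ B* p` selected by the maximum principle. -/
noncomputable def feedback (P : ControlProblem H U) (p : ℝ → H) (s : ℝ) : U :=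
  -P.N.symm (ContinuousLinearMap.adjoint P.B (p s))

/-- The running payoff along a curve driven by the feedback control. -/
noncomputable def runningCost (P : ControlProblem H U) (x p : ℝ → H) (s : ℝ) : ℝ :=
  P.F (x s) + (1 / 2) * inner ℝ (p s) (P.K (p s))

theorem B_feedback (P : ControlProblem H U) (p : ℝ → H) (s : ℝ) :
    P.B (P.feedback p s) = -P.K (p s) := by
  simp [feedback, K]

theorem N_feedback (P : ControlProblem H U) (p : ℝ → H) (s : ℝ) :
    P.N (P.feedback p s) = -ContinuousLinearMap.adjoint P.B (p s) := by
  simp [feedback]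

theorem inner_feedback (P : ControlProblem H U) (p : ℝ → H) (s : ℝ) :
    (inner ℝ (P.feedback p s) (P.N (P.feedback p s)) : ℝ) = inner ℝ (p s) (P.K (p s)) := by
  rw [N_feedback, inner_neg_right, ContinuousLinearMap.adjoint_inner_right, B_feedback,
    inner_neg_left, neg_neg, real_inner_comm]

theorem IsState.of_hasDerivAt {P : ControlProblem H U} {x : ℝ → H} {t : ℝ}
    {u : ℝ → U} (hx : ∀ s ∈ Icc t P.T, HasDerivAt x (P.A (x s) + P.B (u s)) s)
    (hc : ContinuousOn (fun s => P.A (x s) + P.B (u s)) (Icc t P.T)) :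
    P.IsState (x t) t u x := by
  refine ⟨fun s hs => (hx s hs).continuousAt.continuousWithinAt, fun s hs => ?_⟩
  have hsub : uIcc t s ⊆ Icc t P.T := by
    rw [uIcc_of_le hs.1]
    exact Icc_subset_Icc_right hs.2
  rw [intervalIntegral.integral_eq_sub_of_hasDerivAt (fun r hr => hx r (hsub hr))
    (hc.mono hsub).intervalIntegrable]
  abel

theorem isControl_of_continuousOn {P : ControlProblem H U} {t : ℝ} {u : ℝ → U}
    (hu : ContinuousOn u (Icc t P.T)) : P.IsControl t u := by
  obtain ⟨C, hC⟩ := isCompact_Icc.exists_bound_of_continuousOn hu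
  refine MemLp.of_bound ((hu.mono Ioc_subset_Icc_self).aestronglyMeasurable measurableSet_Ioc) C ?_
  exact (ae_restrict_iff' measurableSet_Ioc).2
    (Eventually.of_forall fun s hs => hC s (Ioc_subset_Icc_self hs))

theorem IsControl.intervalIntegrable {P : ControlProblem H U} {t : ℝ} {v : ℝ → U}
    (ht : t ≤ P.T) (hv : P.IsControl t v) : IntervalIntegrable v volume t P.T :=
  (intervalIntegrable_iff_integrableOn_Ioc_of_le ht).2 (hv.integrable one_le_two)

theorem IsControl.intervalIntegrable_inner {P : ControlProblem H U} {t : ℝ} {v : ℝ → U}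
    (ht : t ≤ P.T) (hv : P.IsControl t v) :
    IntervalIntegrable (fun s => (inner ℝ (v s) (P.N (v s)) : ℝ)) volume t P.T := by
  refine (intervalIntegrable_iff_integrableOn_Ioc_of_le ht).2 ?_
  have h1 := (memLp_two_iff_integrable_sq_norm hv.1).1 hv
  refine (h1.const_mul ‖(P.N : U →L[ℝ] U)‖).mono'
    (hv.1.inner (P.N.continuous.comp_aestronglyMeasurable hv.1)) (Eventually.of_forall fun s => ?_)
  refine (norm_inner_le_norm _ _).trans ?_
  have := (P.N : U →L[ℝ] U).le_opNorm (v s)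
  calc ‖v s‖ * ‖P.N (v s)‖ ≤ ‖v s‖ * (‖(P.N : U →L[ℝ] U)‖ * ‖v s‖) := by
        gcongr
        exact this
    _ = _ := by ring

section Curve

variable {P : ControlProblem H U} {γ b ν M νT MT m : ℝ} {x p : ℝ → H} {t : ℝ}

theorem IsHamiltonianCurve.continuousOn_feedback (hxp : P.IsHamiltonianCurve x p) :
    ContinuousOn (P.feedback p) (Ioo (-1) (P.T + 1)) :=
  (P.N.symm.continuous.comp_continuousOn
    ((ContinuousLinearMap.adjoint P.B).continuous.comp_continuousOn hxp.continuousOn_adjoint)).neg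

theorem IsHamiltonianCurve.isControl (hxp : P.IsHamiltonianCurve x p) (ht : t ∈ Icc 0 P.T) :
    P.IsControl t (P.feedback p) :=
  isControl_of_continuousOn (hxp.continuousOn_feedback.mono
    ((Icc_subset_Icc_left ht.1).trans P.Icc_subset_Ioo_time))

theorem Regular.isState (h : P.Regular γ b ν M νT MT m) (hxp : P.IsHamiltonianCurve x p)
    (ht : t ∈ Icc 0 P.T) : P.IsState (x t) t (P.feedback p) x := by
  have hsub : Icc t P.T ⊆ Ioo (-1) (P.T + 1) :=
    (Icc_subset_Icc_left ht.1).trans P.Icc_subset_Ioo_time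
  refine IsState.of_hasDerivAt (fun s hs => ?_) ?_
  · rw [B_feedback, ← sub_eq_add_neg]
    exact hxp.state s (hsub hs)
  · exact (h.differentiable_A.continuous.comp_continuousOn (hxp.continuousOn_state.mono hsub)).add
      (P.B.continuous.comp_continuousOn (hxp.continuousOn_feedback.mono hsub))

theorem Regular.continuousOn_runningCost (h : P.Regular γ b ν M νT MT m) {J : Set ℝ}
    (hx : ContinuousOn x J) (hp : ContinuousOn p J) : ContinuousOn (P.runningCost x p) J :=
  (h.running.continuous.comp_continuousOn hx).add
    (continuousOn_const.mul (hp.inner (P.K.continuous.comp_continuousOn hp)))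

theorem Regular.payoff_feedback (h : P.Regular γ b ν M νT MT m) (hxp : P.IsHamiltonianCurve x p)
    (ht : t ∈ Icc 0 P.T) :
    P.payoff t (P.feedback p) x = (∫ s in t..P.T, P.runningCost x p s) + P.FT (x P.T) := by
  have hsub : uIcc t P.T ⊆ Ioo (-1) (P.T + 1) := by
    rw [uIcc_of_le ht.2]
    exact (Icc_subset_Icc_left ht.1).trans P.Icc_subset_Ioo_time
  simp only [payoff, runningCost, inner_feedback]
  have hp := hxp.continuousOn_adjoint.mono hsub
  have h1 : IntervalIntegrable (fun s => P.F (x s)) volume t P.T :=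
    (h.running.continuous.comp_continuousOn (hxp.continuousOn_state.mono hsub)).intervalIntegrable
  have h2 : IntervalIntegrable (fun s => (1 / 2) * (inner ℝ (p s) (P.K (p s)) : ℝ)) volume t P.T :=
    (continuousOn_const.mul (hp.inner (P.K.continuous.comp_continuousOn hp))).intervalIntegrable
  rw [intervalIntegral.integral_add h1 h2, intervalIntegral.integral_const_mul]
  ring

end Curve

namespace Controlled

variable {P : ControlProblem H U} {γ b ν M νT MT m α : ℝ} {x p : ℝ → H} {t : ℝ}

/-- The pointwise inequality behind the optimality of extremals. -/
theorem integrand_nonneg (h : P.Controlled γ b ν M νT MT m α) {s : ℝ} {y : H} {w : U}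
    (hp : ‖p s‖ ≤ α * ‖x s‖) :
    0 ≤ (P.F y - P.F (x s)) + (1 / 2) * (inner ℝ w (P.N w)
        - inner ℝ (P.feedback p s) (P.N (P.feedback p s)))
      + (inner ℝ (-(ContinuousLinearMap.adjoint (fderiv ℝ P.A (x s)) (p s) + gradient P.F (x s)))
          (y - x s)
        + inner ℝ (p s) (P.A y + P.B w - (P.A (x s) + P.B (P.feedback p s)))) := by
  have h1 := h.running.lower (x s) y
  have h2 := (abs_le.1 (h.abs_inner_remainder_le hp h.α_nonneg y)).1
  -- The control terms complete to this square because `N u = -B* p` for the feedback `u`. The drift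
  -- remainder `bα/2` is paid by the `ν/2` of `F`.
  have h3 := h.N_nonneg (w - P.feedback p s)
  have h4 : ∀ u : U, (inner ℝ (p s) (P.B u) : ℝ) = -inner ℝ (P.N (P.feedback p s)) u := fun u => by
    rw [N_feedback, inner_neg_left, neg_neg, ContinuousLinearMap.adjoint_inner_left]
  have h5 := h.N_symm (P.feedback p s) w
  have h6 := h.N_symm (P.feedback p s) (P.feedback p s)
  have h7 : 0 ≤ (ν - b * α) / 2 * ‖y - x s‖ ^ 2 := by
    have := h.b_mul_lt
    have : 0 ≤ ν - b * α := by linarith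
    positivity
  have h8 := real_inner_comm w (P.N (P.feedback p s))
  rw [Regular.inner_neg_adjoint_add_gradient]
  simp only [inner_sub_right, inner_sub_left, inner_add_right, map_sub, h4] at h2 h3 ⊢
  simp only [inner_sub_right] at h1
  linarith

/-- Every extremal provides an affine lower bound for all payoffs. -/
theorem payoff_extremal_add_le (h : P.Controlled γ b ν M νT MT m α) (he : P.IsExtremal x p)
    (ht : t ∈ Icc 0 P.T) {v : ℝ → U} {y : ℝ → H} {y₀ : H} (hv : P.IsControl t v)
    (hy : P.IsState y₀ t v y) :
    P.payoff t (P.feedback p) x + inner ℝ (p t) (y₀ - x t) ≤ P.payoff t v y := by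
  have hsub0 : Icc t P.T ⊆ Icc 0 P.T := Icc_subset_Icc_left ht.1
  have hsub : Icc t P.T ⊆ Ioo (-1) (P.T + 1) := hsub0.trans P.Icc_subset_Ioo_time
  have huIcc : uIcc t P.T = Icc t P.T := uIcc_of_le ht.2
  have hu := he.isControl ht
  have hxs := h.isState he.toIsHamiltonianCurve ht
  have hA := h.differentiable_A.continuous
  have hdrift : ∀ {z₀ : H} {w : ℝ → U} {z : ℝ → H}, P.IsControl t w → P.IsState z₀ t w z →
      IntervalIntegrable (fun s => P.A (z s) + P.B (w s)) volume t P.T := fun hw hz => by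
    refine IntervalIntegrable.add ?_ ?_
    · refine ContinuousOn.intervalIntegrable ?_
      rw [huIcc]
      exact hA.comp_continuousOn hz.1
    · exact ⟨P.B.integrable_comp (hw.intervalIntegrable ht.2).1,
        P.B.integrable_comp (hw.intervalIntegrable ht.2).2⟩
  set p' : ℝ → H := fun s =>
    -(ContinuousLinearMap.adjoint (fderiv ℝ P.A (x s)) (p s) + gradient P.F (x s)) with hp'
  set g : ℝ → H := fun s => P.A (y s) + P.B (v s) - (P.A (x s) + P.B (P.feedback p s)) with hg
  have hgi : IntervalIntegrable g volume t P.T := (hdrift hv hy).sub (hdrift hu hxs)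
  have hXeq : ∀ s ∈ Icc t P.T, y s - x s = (y₀ - x t) + ∫ r in t..s, g r := by
    intro s hs
    have hss : uIcc t s ⊆ uIcc t P.T := by
      rw [huIcc, uIcc_of_le hs.1]
      exact Icc_subset_Icc_right hs.2
    rw [hg, intervalIntegral.integral_sub ((hdrift hv hy).mono_set hss)
      ((hdrift hu hxs).mono_set hss), hy.2 s hs]
    nth_rewrite 1 [hxs.2 s hs]
    abel
  have hxc := he.continuousOn_state.mono hsub
  have hpc := he.continuousOn_adjoint.mono hsub
  have hp'c : ContinuousOn p' (Icc t P.T) := by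
    refine ContinuousOn.neg (ContinuousOn.add ?_
      (h.running.continuous_gradient.comp_continuousOn hxc))
    exact ((ContinuousLinearMap.adjoint (𝕜 := ℝ) (E := H) (F := H)).continuous.comp_continuousOn
      (h.continuous_fderiv.comp_continuousOn hxc)).clm_apply hpc
  have hXc : ContinuousOn (fun s => y s - x s) (Icc t P.T) := hy.1.sub hxc
  -- The boundary term at `T` is `(DF_T(x(T)), y(T) - x(T))` by transversality, which convexity of
  -- `F_T` handles; the one at `t` is the affine term of the claim.
  have parts := integral_inner_add_inner_eq_sub ht.2 (fun s hs => he.adjoint s (hsub hs)) hp'c hgi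
    hXeq
  have hi1 : IntervalIntegrable (fun s => P.F (y s)) volume t P.T := by
    refine ContinuousOn.intervalIntegrable ?_
    rw [huIcc]
    exact h.running.continuous.comp_continuousOn hy.1
  have hi2 : IntervalIntegrable (fun s => P.F (x s)) volume t P.T := by
    refine ContinuousOn.intervalIntegrable ?_
    rw [huIcc]
    exact h.running.continuous.comp_continuousOn hxc
  have hi3 := hv.intervalIntegrable_inner ht.2
  have hi4 := hu.intervalIntegrable_inner ht.2
  have hi5 : IntervalIntegrable (fun s => (inner ℝ (p' s) (y s - x s) : ℝ)) volume t P.T := by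
    refine ContinuousOn.intervalIntegrable ?_
    rw [huIcc]
    exact hp'c.inner hXc
  have hi6 : IntervalIntegrable (fun s => (inner ℝ (p s) (g s) : ℝ)) volume t P.T := by
    obtain ⟨C, hC⟩ := isCompact_Icc.exists_bound_of_continuousOn hpc
    rw [intervalIntegrable_iff_integrableOn_Ioc_of_le ht.2] at hgi ⊢
    refine (hgi.norm.const_mul C).mono'
      (((hpc.mono Ioc_subset_Icc_self).aestronglyMeasurable measurableSet_Ioc).inner hgi.1) ?_
    refine (ae_restrict_iff' measurableSet_Ioc).2 (Eventually.of_forall fun s hs => ?_)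
    refine (norm_inner_le_norm _ _).trans ?_
    gcongr
    exact hC s (Ioc_subset_Icc_self hs)
  have hpos := intervalIntegral.integral_nonneg (μ := volume) ht.2 fun s hs =>
    h.integrand_nonneg (y := y s) (w := v s) (h.apriori _ _ he s (hsub0 hs))
  rw [intervalIntegral.integral_add ((hi1.sub hi2).add ((hi3.sub hi4).const_mul (1 / 2)))
      (hi5.add hi6), intervalIntegral.integral_add (hi1.sub hi2) ((hi3.sub hi4).const_mul (1 / 2)),
    intervalIntegral.integral_sub hi1 hi2, intervalIntegral.integral_const_mul,
    intervalIntegral.integral_sub hi3 hi4, parts] at hpos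
  have hterm := h.terminal.lower (x P.T) (y P.T)
  have hterm' : 0 ≤ νT / 2 * ‖y P.T - x P.T‖ ^ 2 := by
    have := h.terminal.low_pos
    positivity
  have hyt : y t = y₀ := by
    have := hy.2 t (left_mem_Icc.2 ht.2)
    simpa using this
  rw [← he.transversality] at hterm
  rw [hyt] at hpos
  simp only [payoff]
  linarith

theorem isLeast_payoffs (h : P.Controlled γ b ν M νT MT m α) (he : P.IsExtremal x p)
    (ht : t ∈ Icc 0 P.T) : IsLeast (P.payoffs (x t) t) (P.payoff t (P.feedback p) x) := by
  refine ⟨⟨_, _, he.isControl ht, h.isState he.toIsHamiltonianCurve ht, rfl⟩, ?_⟩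
  rintro c ⟨v, y, hv, hy, rfl⟩
  have := h.payoff_extremal_add_le he ht hv hy
  simpa using this

theorem value_eq (h : P.Controlled γ b ν M νT MT m α) (he : P.IsExtremal x p)
    (ht : t ∈ Icc 0 P.T) :
    P.value (x t) t = (∫ s in t..P.T, P.runningCost x p s) + P.FT (x P.T) := by
  rw [value, (h.isLeast_payoffs he ht).csInf_eq, h.payoff_feedback he.toIsHamiltonianCurve ht]

theorem isGLB_value (h : P.Controlled γ b ν M νT MT m α) (x₀ : H) (ht : t ∈ Icc 0 P.T) :
    IsGLB (P.payoffs x₀ t) (P.value x₀ t) := by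
  obtain ⟨x, p, he, rfl⟩ := h.exists_isExtremal x₀ ht
  have := h.isLeast_payoffs he ht
  rw [value, this.csInf_eq]
  exact this.isGLB

/-- The affine bound, tested on the optimal control from `y₀`, makes `p(t)` a subgradient of the
value function. -/
theorem value_add_inner_le (h : P.Controlled γ b ν M νT MT m α) (he : P.IsExtremal x p)
    (ht : t ∈ Icc 0 P.T) (y₀ : H) : P.value (x t) t + inner ℝ (p t) (y₀ - x t) ≤ P.value y₀ t := by
  obtain ⟨y, q, hq, rfl⟩ := h.exists_isExtremal y₀ ht
  rw [h.value_eq he ht, h.value_eq hq ht, ← h.payoff_feedback he.toIsHamiltonianCurve ht,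
    ← h.payoff_feedback hq.toIsHamiltonianCurve ht]
  exact h.payoff_extremal_add_le he ht (hq.isControl ht) (h.isState hq.toIsHamiltonianCurve ht)

end Controlled

end ControlProblem

/-! ### Regularity of the value function and the Bellman equation. -/

/-- The spatial part of the chain rule for a function with jointly continuous spatial gradient. -/
theorem hasDerivWithinAt_sub_of_continuousOn_gradient {H : Type*} [NormedAddCommGroup H]
    [InnerProductSpace ℝ H] [CompleteSpace H] {W : H → ℝ → ℝ} {G : H → ℝ → H} {I : Set ℝ} {t : ℝ}
    (ht : t ∈ I) (hW : ∀ s ∈ I, ∀ x, HasGradientAt (fun z => W z s) (G x s) x)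
    (hG : ContinuousOn (fun q : H × ℝ => G q.1 q.2) (univ ×ˢ I)) {z : ℝ → H} {z' : H}
    (hz : HasDerivWithinAt z z' I t) :
    HasDerivWithinAt (fun r => W (z r) r - W (z t) r) (inner ℝ (G (z t) t) z') I t := by
  have hlin : HasDerivWithinAt (fun r => (inner ℝ (G (z t) t) (z r - z t) : ℝ))
      (inner ℝ (G (z t) t) z') I t := by
    simpa using (hasDerivWithinAt_const t I (G (z t) t)).inner ℝ (hz.sub_const (z t))
  -- At each fixed time `r`, the mean value inequality on a ball around `z t`, where joint
  -- continuity keeps the gradient within `ε` of `G (z t) t`. No differentiability in time enters.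
  have hrem : (fun r => W (z r) r - W (z t) r - inner ℝ (G (z t) t) (z r - z t))
      =o[𝓝[I] t] fun r => r - t := by
    refine Asymptotics.IsLittleO.trans_isBigO (g := fun r => z r - z t) ?_
      (hz.isBigO_sub.comp_tendsto (tendsto_id.prodMk tendsto_const_pure))
    refine Asymptotics.isLittleO_iff.2 fun ε hε => ?_
    have hc := hG (z t, t) ⟨mem_univ _, ht⟩
    obtain ⟨δ, hδ, hball⟩ := Metric.continuousWithinAt_iff.1 hc ε hε
    have hz0 : ∀ᶠ r in 𝓝[I] t, dist (z r) (z t) < δ :=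
      Metric.tendsto_nhds.1 hz.continuousWithinAt δ hδ
    have ht0 : ∀ᶠ r in 𝓝[I] t, dist r t < δ :=
      eventually_nhdsWithin_of_eventually_nhds (Metric.ball_mem_nhds t hδ)
    filter_upwards [hz0, ht0, self_mem_nhdsWithin] with r hr1 hr2 hrI
    have := (convex_ball (z t) δ).norm_image_sub_le_of_norm_hasFDerivWithin_le'
      (f := fun x => W x r) (f' := fun x => InnerProductSpace.toDual ℝ H (G x r))
      (φ := InnerProductSpace.toDual ℝ H (G (z t) t)) (C := ε)
      (fun x _ => (hW r hrI x).hasFDerivAt.hasFDerivWithinAt)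
      (fun x hx => by
        rw [← map_sub, LinearIsometryEquiv.norm_map, ← dist_eq_norm]
        refine (hball (x := (x, r)) ⟨mem_univ _, hrI⟩ ?_).le
        exact max_lt hx hr2)
      (Metric.mem_ball_self hδ) (show z r ∈ Metric.ball (z t) δ from hr1)
    simpa using this
  have hrem' : HasDerivWithinAt
      (fun r => W (z r) r - W (z t) r - inner ℝ (G (z t) t) (z r - z t)) 0 I t := by
    rw [hasDerivWithinAt_iff_isLittleO]
    simpa using hrem
  simpa using hrem'.fun_add hlin

namespace ControlProblem

variable {H U : Type*}
  [NormedAddCommGroup H] [InnerProductSpace ℝ H] [CompleteSpace H]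
  [NormedAddCommGroup U] [InnerProductSpace ℝ U] [CompleteSpace U]

namespace Controlled

variable {P : ControlProblem H U} {γ b ν M νT MT m α : ℝ} {x p : ℝ → H} {t : ℝ}

/-- The subgradient inequalities at `x t` and at a nearby point trap the first-order error between
`0` and `(q - p, y - x) ≤ β‖y - x‖²`. -/
theorem hasGradientAt_value (h : P.Controlled γ b ν M νT MT m α) (he : P.IsExtremal x p)
    (ht : t ∈ Icc 0 P.T) : HasGradientAt (fun z => P.value z t) (p t) (x t) := by
  obtain ⟨β, hβ, hlip⟩ := h.exists_norm_adjoint_sub_le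
  rw [hasGradientAt_iff_isLittleO]
  have hO : (fun y => P.value y t - P.value (x t) t - inner ℝ (p t) (y - x t))
      =O[𝓝 (x t)] fun y => ‖y - x t‖ ^ 2 := by
    refine Asymptotics.IsBigO.of_bound β (Eventually.of_forall fun y₀ => ?_)
    obtain ⟨y, q, hq, rfl⟩ := h.exists_isExtremal y₀ ht
    have h1 := h.value_add_inner_le he ht (y t)
    have h2 := h.value_add_inner_le hq ht (x t)
    have h3 : (inner ℝ (q t - p t) (y t - x t) : ℝ) ≤ β * ‖y t - x t‖ ^ 2 := by
      refine (real_inner_le_norm _ _).trans ?_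
      have := hlip _ _ _ _ hq he t ht
      calc ‖q t - p t‖ * ‖y t - x t‖ ≤ β * ‖y t - x t‖ * ‖y t - x t‖ := by gcongr
        _ = _ := by ring
    rw [Real.norm_of_nonneg (by linarith), Real.norm_of_nonneg (by positivity)]
    rw [← neg_sub (y t) (x t), inner_neg_right] at h2
    rw [inner_sub_left] at h3
    linarith
  refine hO.trans_isLittleO ?_
  have h1 : (fun y : H => ‖y - x t‖) =o[𝓝 (x t)] fun _ => (1 : ℝ) := by
    rw [Asymptotics.isLittleO_one_iff]
    have : ContinuousAt (fun y : H => ‖y - x t‖) (x t) := by fun_prop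
    simpa [ContinuousAt] using this
  have h2 := h1.mul_isBigO (Asymptotics.isBigO_refl (fun y : H => ‖y - x t‖) (𝓝 (x t)))
  simp only [one_mul, ← pow_two] at h2
  exact h2.norm_right.congr_right (fun y => by simp) |>.of_norm_right

theorem gradient_value (h : P.Controlled γ b ν M νT MT m α) (he : P.IsExtremal x p)
    (ht : t ∈ Icc 0 P.T) : gradient (fun z => P.value z t) (x t) = p t :=
  (h.hasGradientAt_value he ht).gradient

theorem hasGradientAt_value_gradient (h : P.Controlled γ b ν M νT MT m α) (ht : t ∈ Icc 0 P.T)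
    (x₀ : H) :
    HasGradientAt (fun z => P.value z t) (gradient (fun z => P.value z t) x₀) x₀ := by
  obtain ⟨x, p, he, rfl⟩ := h.exists_isExtremal x₀ ht
  rw [h.gradient_value he ht]
  exact h.hasGradientAt_value he ht

theorem exists_norm_gradient_value_sub_le (h : P.Controlled γ b ν M νT MT m α) :
    ∃ β : ℝ, 0 ≤ β ∧ ∀ t ∈ Icc 0 P.T, ∀ x₀ y₀ : H,
      ‖gradient (fun z => P.value z t) x₀ - gradient (fun z => P.value z t) y₀‖
        ≤ β * ‖x₀ - y₀‖ := by
  obtain ⟨β, hβ, hlip⟩ := h.exists_norm_adjoint_sub_le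
  refine ⟨β, hβ, fun t ht x₀ y₀ => ?_⟩
  obtain ⟨x, p, he, rfl⟩ := h.exists_isExtremal x₀ ht
  obtain ⟨y, q, hq, rfl⟩ := h.exists_isExtremal y₀ ht
  rw [h.gradient_value he ht, h.gradient_value hq ht]
  exact hlip _ _ _ _ he hq t ht

/-- A nearby point is compared with the extremal through the given one at the same time: the
gradient is Lipschitz in space uniformly in time, and along the extremal it is the continuous curve
`p`. -/
theorem continuousOn_gradient_value (h : P.Controlled γ b ν M νT MT m α) :
    ContinuousOn (fun q : H × ℝ => gradient (fun z => P.value z q.2) q.1)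
      (univ ×ˢ Icc 0 P.T) := by
  obtain ⟨β, hβ, hlip⟩ := h.exists_norm_gradient_value_sub_le
  rintro ⟨x₀, t⟩ ⟨-, ht⟩
  change t ∈ Icc 0 P.T at ht
  obtain ⟨x, p, he, rfl⟩ := h.exists_isExtremal x₀ ht
  change Tendsto _ _ (𝓝 (gradient (fun z => P.value z t) (x t)))
  rw [h.gradient_value he ht, tendsto_iff_norm_sub_tendsto_zero]
  have htime := P.Icc_subset_Ioo_time ht
  have hx : ContinuousAt x t := (he.state t htime).continuousAt
  have hp : ContinuousAt p t := (he.adjoint t htime).continuousAt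
  have hlim : Tendsto (fun q : H × ℝ => β * ‖q.1 - x q.2‖ + ‖p q.2 - p t‖)
      (𝓝[univ ×ˢ Icc 0 P.T] (x t, t)) (𝓝 0) := by
    refine tendsto_nhdsWithin_of_tendsto_nhds ?_
    have hx' : ContinuousAt (fun q : H × ℝ => x q.2) (x t, t) :=
      ContinuousAt.comp (f := Prod.snd) (x := ((x t, t) : H × ℝ)) hx continuousAt_snd
    have hp' : ContinuousAt (fun q : H × ℝ => p q.2) (x t, t) :=
      ContinuousAt.comp (f := Prod.snd) (x := ((x t, t) : H × ℝ)) hp continuousAt_snd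
    have hc : ContinuousAt (fun q : H × ℝ => β * ‖q.1 - x q.2‖ + ‖p q.2 - p t‖) (x t, t) :=
      (continuousAt_const.mul (continuousAt_fst.sub hx').norm).add (hp'.sub continuousAt_const).norm
    simpa [ContinuousAt] using hc
  refine squeeze_zero' (Eventually.of_forall fun _ => norm_nonneg _) ?_ hlim
  filter_upwards [self_mem_nhdsWithin] with q hq
  have h1 := hlip q.2 hq.2 q.1 (x q.2)
  rw [h.gradient_value he hq.2] at h1
  calc _ ≤ ‖gradient (fun z => P.value z q.2) q.1 - p q.2‖ + ‖p q.2 - p t‖ :=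
        norm_sub_le_norm_sub_add_norm_sub _ _ _
    _ ≤ _ := by gcongr

/-- Along the extremal the value is the remaining cost, with derivative minus the running cost.
Subtracting the spatial part of the chain rule leaves the time derivative at the frozen state. -/
theorem hasDerivWithinAt_value_time (h : P.Controlled γ b ν M νT MT m α) (he : P.IsExtremal x p)
    (ht : t ∈ Icc 0 P.T) :
    HasDerivWithinAt (P.value (x t))
      (-P.runningCost x p t - inner ℝ (p t) (P.A (x t) - P.K (p t))) (Icc 0 P.T) t := by
  have htime := P.Icc_subset_Ioo_time ht
  have hT : P.T ∈ Ioo (-1) (P.T + 1) := P.Icc_subset_Ioo_time (right_mem_Icc.2 h.T_pos.le)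
  have h1 : HasDerivWithinAt (fun r => P.value (x r) r) (-P.runningCost x p t) (Icc 0 P.T) t := by
    have h2 := hasDerivAt_integral_of_continuousOn_Ioo
      (h.continuousOn_runningCost he.continuousOn_state he.continuousOn_adjoint) hT htime
    have h3 := (h2.neg.add_const (P.FT (x P.T))).hasDerivWithinAt (s := Icc 0 P.T)
    refine h3.congr_of_mem (fun r hr => ?_) ht
    rw [h.value_eq he hr, intervalIntegral.integral_symm]
    rfl
  have h4 := hasDerivWithinAt_sub_of_continuousOn_gradient ht
    (fun s hs x₀ => h.hasGradientAt_value_gradient hs x₀) h.continuousOn_gradient_value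
    (he.state t htime).hasDerivWithinAt
  rw [h.gradient_value he ht] at h4
  have h5 := h1.fun_sub h4
  simpa using h5

/-- The supporting affine functions at `x₀` and at the moving point bound the value from below and
above; both converge because the gradient is continuous. -/
theorem continuousOn_value (h : P.Controlled γ b ν M νT MT m α) :
    ContinuousOn (fun q : H × ℝ => P.value q.1 q.2) (univ ×ˢ Icc 0 P.T) := by
  rintro ⟨x₀, t⟩ ⟨-, ht⟩
  change t ∈ Icc 0 P.T at ht
  have hsnd : Tendsto (fun q : H × ℝ => q.2) (𝓝[univ ×ˢ Icc 0 P.T] (x₀, t)) (𝓝[Icc 0 P.T] t) :=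
    tendsto_nhdsWithin_iff.2 ⟨tendsto_nhdsWithin_of_tendsto_nhds continuousAt_snd, by
      filter_upwards [self_mem_nhdsWithin] with q hq using hq.2⟩
  have hV : Tendsto (fun q : H × ℝ => P.value x₀ q.2) (𝓝[univ ×ˢ Icc 0 P.T] (x₀, t))
      (𝓝 (P.value x₀ t)) := by
    obtain ⟨x, p, he, rfl⟩ := h.exists_isExtremal x₀ ht
    have hc : Tendsto (P.value (x t)) (𝓝[Icc 0 P.T] t) (𝓝 (P.value (x t) t)) :=
      (h.hasDerivWithinAt_value_time he ht).continuousWithinAt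
    exact hc.comp hsnd
  have hdiff : Tendsto (fun q : H × ℝ => q.1 - x₀) (𝓝[univ ×ˢ Icc 0 P.T] (x₀, t)) (𝓝 0) := by
    refine tendsto_nhdsWithin_of_tendsto_nhds ?_
    have : ContinuousAt (fun q : H × ℝ => q.1 - x₀) (x₀, t) := by fun_prop
    simpa [ContinuousAt] using this
  have hG : Tendsto (fun q : H × ℝ => gradient (fun z => P.value z q.2) q.1)
      (𝓝[univ ×ˢ Icc 0 P.T] (x₀, t)) (𝓝 (gradient (fun z => P.value z t) x₀)) :=
    h.continuousOn_gradient_value (x₀, t) ⟨mem_univ _, ht⟩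
  have hG0 : Tendsto (fun q : H × ℝ => gradient (fun z => P.value z q.2) x₀)
      (𝓝[univ ×ˢ Icc 0 P.T] (x₀, t)) (𝓝 (gradient (fun z => P.value z t) x₀)) := by
    refine hG.comp (f := fun q : H × ℝ => (x₀, q.2)) (tendsto_nhdsWithin_iff.2 ⟨?_, ?_⟩)
    · refine tendsto_nhdsWithin_of_tendsto_nhds ?_
      exact (continuousAt_const.prodMk continuousAt_snd :
        ContinuousAt (fun q : H × ℝ => (x₀, q.2)) (x₀, t))
    · filter_upwards [self_mem_nhdsWithin] with q hq using ⟨mem_univ _, hq.2⟩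
  have hlow := hV.add (hG0.inner hdiff)
  have hup := hV.add (hG.inner hdiff)
  rw [inner_zero_right, add_zero] at hlow hup
  refine tendsto_of_tendsto_of_tendsto_of_le_of_le' hlow hup ?_ ?_
  · filter_upwards [self_mem_nhdsWithin] with q hq
    obtain ⟨x, p, he, hx⟩ := h.exists_isExtremal x₀ hq.2
    rw [← hx, h.gradient_value he hq.2]
    exact h.value_add_inner_le he hq.2 q.1
  · filter_upwards [self_mem_nhdsWithin] with q hq
    obtain ⟨y, p, he, hy⟩ := h.exists_isExtremal q.1 hq.2
    have h1 := h.value_add_inner_le he hq.2 x₀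
    rw [← h.gradient_value he hq.2, hy, ← neg_sub q.1 x₀, inner_neg_right] at h1
    linarith

theorem isBellmanSolution_value (h : P.Controlled γ b ν M νT MT m α) :
    P.IsBellmanSolution (Icc 0 P.T) P.value := by
  refine ⟨h.continuousOn_value, ?_, ?_, h.continuousOn_gradient_value, ?_, ?_, ?_⟩
  · intro t ht x₀
    exact (h.hasGradientAt_value_gradient ht x₀).differentiableAt
  · intro t ht x₀
    obtain ⟨x, p, he, rfl⟩ := h.exists_isExtremal x₀ ht
    exact (h.hasDerivWithinAt_value_time he ht).differentiableWithinAt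
  · intro t₀ _ x₀
    obtain ⟨β, hβ, hlip⟩ := h.exists_norm_gradient_value_sub_le
    exact ⟨1, one_pos, β, fun t ht _ x _ x' _ => hlip t ht x x'⟩
  · intro t ht x₀
    obtain ⟨x, p, he, rfl⟩ := h.exists_isExtremal x₀ ht
    rw [(h.hasDerivWithinAt_value_time he ht).derivWithin (uniqueDiffOn_Icc h.T_pos t ht),
      h.gradient_value he ht, runningCost, inner_sub_right]
    ring
  · intro x₀
    have hT : P.T ∈ Icc 0 P.T := right_mem_Icc.2 h.T_pos.le
    obtain ⟨x, p, he, rfl⟩ := h.exists_isExtremal x₀ hT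
    rw [h.value_eq he hT]
    simp

end Controlled

end ControlProblem

/-! ### Uniqueness: characteristics of an arbitrary solution. -/

namespace ControlProblem

variable {H U : Type*}
  [NormedAddCommGroup H] [InnerProductSpace ℝ H] [CompleteSpace H]
  [NormedAddCommGroup U] [InnerProductSpace ℝ U] [CompleteSpace U]

/-- The spatial gradient of `W` at the point `x` and the time `t`. -/
noncomputable def spatialGradient (W : H → ℝ → ℝ) (x : H) (t : ℝ) : H :=
  gradient (fun z => W z t) x

namespace IsBellmanSolution

variable {P : ControlProblem H U} {γ b ν M νT MT m : ℝ} {W : H → ℝ → ℝ}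

theorem hasGradientAt (hW : P.IsBellmanSolution (Ioo 0 P.T) W) {t : ℝ} (ht : t ∈ Ioo 0 P.T)
    (x : H) : HasGradientAt (fun z => W z t) (spatialGradient W x t) x :=
  (hW.differentiableAt_state t ht x).hasGradientAt

theorem continuousOn_spatialGradient (hW : P.IsBellmanSolution (Ioo 0 P.T) W) :
    ContinuousOn (fun q : H × ℝ => spatialGradient W q.1 q.2) (univ ×ˢ Ioo 0 P.T) :=
  hW.continuousOn_gradient

theorem continuousOn_spatialGradient_comp (hW : P.IsBellmanSolution (Ioo 0 P.T) W) {y : ℝ → H}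
    {J : Set ℝ} (hJ : J ⊆ Ioo 0 P.T) (hy : ContinuousOn y J) :
    ContinuousOn (fun s => spatialGradient W (y s) s) J :=
  hW.continuousOn_spatialGradient.comp (hy.prodMk continuousOn_id) fun _ hs => ⟨mem_univ _, hJ hs⟩

/-- The derivative of a solution along a curve with velocity `A(y) - K q`. -/
theorem hasDerivAt_along (h : P.Regular γ b ν M νT MT m)
    (hW : P.IsBellmanSolution (Ioo 0 P.T) W) {t : ℝ} (ht : t ∈ Ioo 0 P.T) {y q : ℝ → H}
    (hy : HasDerivAt y (P.A (y t) - P.K (q t)) t) :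
    HasDerivAt (fun r => W (y r) r) (-P.runningCost y q t
      + (1 / 2) * inner ℝ (spatialGradient W (y t) t - q t)
          (P.K (spatialGradient W (y t) t - q t))) t := by
  have hnhds : Ioo 0 P.T ∈ 𝓝 t := isOpen_Ioo.mem_nhds ht
  have h1 := (hasDerivWithinAt_sub_of_continuousOn_gradient ht (fun s hs x => hW.hasGradientAt hs x)
    hW.continuousOn_spatialGradient hy.hasDerivWithinAt).hasDerivAt hnhds
  have h2 := (hW.differentiableWithinAt_time t ht (y t)).hasDerivWithinAt.hasDerivAt hnhds
  have h3 := hW.equation t ht (y t)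
  change _ - (inner ℝ (spatialGradient W (y t) t) _ : ℝ)
    + (1 / 2) * inner ℝ (spatialGradient W (y t) t) (P.K (spatialGradient W (y t) t)) = _ at h3
  -- With `G` the gradient, symmetry of `K` completes the square: `½(G, KG) - (G, Kq) = ½(G - q, K(G
  -- - q)) - ½(q, Kq)`.
  have h4 := h.K_symm (q t) (spatialGradient W (y t) t)
  have h5 := real_inner_comm (P.K (q t)) (spatialGradient W (y t) t)
  have h6 := h1.fun_add h2
  simp only [sub_add_cancel] at h6
  refine h6.congr_deriv ?_
  simp only [runningCost, inner_sub_left, inner_sub_right, map_sub]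
  linarith

/-- The gain of a solution along a curve with velocity `A(y) - K q`, compensated by the running
cost. -/
theorem hasDerivAt_along_add_integral (h : P.Regular γ b ν M νT MT m)
    (hW : P.IsBellmanSolution (Ioo 0 P.T) W) {t₁ t₂ : ℝ} (h1 : 0 ≤ t₁) (h2 : t₂ ≤ P.T)
    {y q : ℝ → H} (hyc : ContinuousOn y (Icc t₁ t₂)) (hqc : ContinuousOn q (Icc t₁ t₂))
    (hy : ∀ s ∈ Ioo t₁ t₂, HasDerivAt y (P.A (y s) - P.K (q s)) s) {s : ℝ} (hs : s ∈ Ioo t₁ t₂) :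
    HasDerivAt (fun r => W (y r) r + ∫ u in t₁..r, P.runningCost y q u)
      ((1 / 2) * inner ℝ (spatialGradient W (y s) s - q s)
          (P.K (spatialGradient W (y s) s - q s))) s := by
  have hrc := h.continuousOn_runningCost hyc hqc
  have hint : HasDerivAt (fun r => ∫ u in t₁..r, P.runningCost y q u) (P.runningCost y q s) s := by
    refine intervalIntegral.integral_hasDerivAt_right ?_ ?_ ?_
    · refine (hrc.mono ?_).intervalIntegrable
      rw [uIcc_of_le hs.1.le]
      exact Icc_subset_Icc_right hs.2.le
    · exact (hrc.mono Ioo_subset_Icc_self).stronglyMeasurableAtFilter isOpen_Ioo s hs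
    · exact hrc.continuousAt (Icc_mem_nhds hs.1 hs.2)
  refine ((hW.hasDerivAt_along h ⟨h1.trans_lt hs.1, hs.2.trans_le h2⟩ (hy s hs)).fun_add
    hint).congr_deriv ?_
  ring

theorem continuousOn_along_add_integral (h : P.Regular γ b ν M νT MT m)
    {I : Set ℝ} (hW : P.IsBellmanSolution I W) {t₁ t₂ : ℝ} (h1 : 0 ≤ t₁) (h2 : t₂ ≤ P.T)
    (h12 : t₁ ≤ t₂) {y q : ℝ → H} (hyc : ContinuousOn y (Icc t₁ t₂))
    (hqc : ContinuousOn q (Icc t₁ t₂)) :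
    ContinuousOn (fun r => W (y r) r + ∫ u in t₁..r, P.runningCost y q u) (Icc t₁ t₂) := by
  refine ContinuousOn.add ?_ ?_
  · exact hW.continuousOn.comp (hyc.prodMk continuousOn_id)
      fun s hs => ⟨mem_univ _, Icc_subset_Icc h1 h2 hs⟩
  · have hrc := h.continuousOn_runningCost hyc hqc
    rw [← uIcc_of_le h12] at hrc ⊢
    exact intervalIntegral.continuousOn_primitive_interval' hrc.intervalIntegrable left_mem_uIcc

theorem le_add_integral (h : P.Regular γ b ν M νT MT m) (hW : P.IsBellmanSolution (Ioo 0 P.T) W)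
    {t₁ t₂ : ℝ} (h1 : 0 ≤ t₁) (h2 : t₂ ≤ P.T) (h12 : t₁ ≤ t₂) {y q : ℝ → H}
    (hyc : ContinuousOn y (Icc t₁ t₂)) (hqc : ContinuousOn q (Icc t₁ t₂))
    (hy : ∀ s ∈ Ioo t₁ t₂, HasDerivAt y (P.A (y s) - P.K (q s)) s) :
    W (y t₁) t₁ ≤ W (y t₂) t₂ + ∫ u in t₁..t₂, P.runningCost y q u := by
  have hd := fun s hs => hW.hasDerivAt_along_add_integral h h1 h2 hyc hqc hy (s := s) hs
  have hmono := monotoneOn_of_deriv_nonneg (convex_Icc t₁ t₂)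
    (hW.continuousOn_along_add_integral h h1 h2 h12 hyc hqc)
    (fun s hs => (hd s (interior_Icc (α := ℝ) ▸ hs)).differentiableAt.differentiableWithinAt)
    (fun s hs => by
      rw [(hd s (interior_Icc (α := ℝ) ▸ hs)).deriv, real_inner_comm]
      have h3 := h.K_ge (spatialGradient W (y s) s - q s)
      have h4 : 0 ≤ m * ‖spatialGradient W (y s) s - q s‖ ^ 2 := by
        have := h.m_pos
        positivity
      linarith)
  have := hmono (left_mem_Icc.2 h12) (right_mem_Icc.2 h12) h12
  simpa using this

theorem eq_add_integral (h : P.Regular γ b ν M νT MT m) (hW : P.IsBellmanSolution (Ioo 0 P.T) W)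
    {t₁ t₂ : ℝ} (h1 : 0 ≤ t₁) (h2 : t₂ ≤ P.T) (h12 : t₁ ≤ t₂) {y q : ℝ → H}
    (hyc : ContinuousOn y (Icc t₁ t₂)) (hqc : ContinuousOn q (Icc t₁ t₂))
    (hy : ∀ s ∈ Ioo t₁ t₂, HasDerivAt y (P.A (y s) - P.K (q s)) s)
    (hq : ∀ s ∈ Ioo t₁ t₂, q s = spatialGradient W (y s) s) :
    W (y t₁) t₁ = W (y t₂) t₂ + ∫ u in t₁..t₂, P.runningCost y q u := by
  refine le_antisymm (hW.le_add_integral h h1 h2 h12 hyc hqc hy) ?_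
  have hd := fun s hs => hW.hasDerivAt_along_add_integral h h1 h2 hyc hqc hy (s := s) hs
  have hanti := antitoneOn_of_deriv_nonpos (convex_Icc t₁ t₂)
    (hW.continuousOn_along_add_integral h h1 h2 h12 hyc hqc)
    (fun s hs => (hd s (interior_Icc (α := ℝ) ▸ hs)).differentiableAt.differentiableWithinAt)
    (fun s hs => by
      have hs' : s ∈ Ioo t₁ t₂ := interior_Icc (α := ℝ) ▸ hs
      rw [(hd s hs').deriv, hq s hs']
      simp)
  have := hanti (left_mem_Icc.2 h12) (right_mem_Icc.2 h12) h12
  simpa using this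

/-- Along a curve driven by its own gradient, the gradient of a solution satisfies the adjoint
equation in integrated form, tested in one direction. The proof translates the curve. -/
theorem inner_spatialGradient_sub (h : P.Regular γ b ν M νT MT m)
    (hW : P.IsBellmanSolution (Ioo 0 P.T) W)
    {t₁ t₂ : ℝ} (h1 : 0 < t₁) (h2 : t₂ < P.T) (h12 : t₁ ≤ t₂) {y : ℝ → H}
    (hyc : ContinuousOn y (Icc t₁ t₂))
    (hy : ∀ s ∈ Ioo t₁ t₂, HasDerivAt y (P.A (y s) - P.K (spatialGradient W (y s) s)) s) (e : H) :
    (inner ℝ (spatialGradient W (y t₂) t₂) e : ℝ) - inner ℝ (spatialGradient W (y t₁) t₁) e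
      = ∫ s in t₁..t₂, inner ℝ (-(ContinuousLinearMap.adjoint (fderiv ℝ P.A (y s))
          (spatialGradient W (y s) s) + gradient P.F (y s))) e := by
  set q : ℝ → H := fun s => spatialGradient W (y s) s with hq
  have hJ : Icc t₁ t₂ ⊆ Ioo 0 P.T := fun s hs => ⟨h1.trans_le hs.1, hs.2.trans_lt h2⟩
  have hqc : ContinuousOn q (Icc t₁ t₂) := hW.continuousOn_spatialGradient_comp hJ hyc
  obtain ⟨L, hL⟩ := h.exists_K_inverse
  obtain ⟨Q, hQ⟩ := isCompact_Icc.exists_bound_of_continuousOn hqc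
  have huIcc : uIcc t₁ t₂ = Icc t₁ t₂ := uIcc_of_le h12
  have hA := h.differentiable_A.continuous
  set ψ : ℝ → ℝ := fun s => inner ℝ (-(ContinuousLinearMap.adjoint (fderiv ℝ P.A (y s)) (q s)
    + gradient P.F (y s))) e with hψ
  have hψc : ContinuousOn ψ (Icc t₁ t₂) := by
    refine ContinuousOn.inner (ContinuousOn.neg (ContinuousOn.add ?_
      (h.running.continuous_gradient.comp_continuousOn hyc))) continuousOn_const
    exact ((ContinuousLinearMap.adjoint (𝕜 := ℝ) (E := H) (F := H)).continuous.comp_continuousOn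
      (h.continuous_fderiv.comp_continuousOn hyc)).clm_apply hqc
  have hrc := h.continuousOn_runningCost hyc hqc
  set C : ℝ := M / 2 * ‖e‖ ^ 2 + |Q| * (b / 2 * ‖e‖ ^ 2) + 1 / 2 * (‖L‖ * (γ * ‖e‖) ^ 2) with hC
  have hγ := h.γ_nonneg
  have hb := h.b_nonneg
  -- Adding `L (A (y + ε e) - A y)` to `q` keeps the velocity unchanged, so the translate `y + ε e`
  -- is again an admissible curve. Its running cost is expanded to first order in `ε`; only an upper
  -- bound on the error is needed.
  have pointwise : ∀ ε : ℝ, ∀ s ∈ Icc t₁ t₂,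
      P.runningCost (fun s => y s + ε • e) (fun s => q s + L (P.A (y s + ε • e) - P.A (y s))) s
        ≤ P.runningCost y q s + (-ε) * ψ s + ε ^ 2 * C := by
    intro ε s hs
    set a := P.A (y s + ε • e) - P.A (y s) with ha
    have hanorm : ‖a‖ ≤ γ * (|ε| * ‖e‖) := by
      have := h.norm_A_sub_le (y s + ε • e) (y s)
      rwa [add_sub_cancel_left, norm_smul, Real.norm_eq_abs] at this
    have e1 : (inner ℝ (q s + L a) (P.K (q s + L a)) : ℝ)
        = inner ℝ (q s) (P.K (q s)) + 2 * inner ℝ (q s) a + inner ℝ (L a) a := by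
      have h3 : (inner ℝ (L a) (P.K (q s)) : ℝ) = inner ℝ (q s) a := by
        rw [← h.K_symm, hL, real_inner_comm]
      rw [map_add, hL]
      simp only [inner_add_left, inner_add_right, h3]
      ring
    have e2 : (inner ℝ (L a) a : ℝ) ≤ ‖L‖ * (γ * (|ε| * ‖e‖)) ^ 2 := by
      refine (real_inner_le_norm _ _).trans ?_
      calc ‖L a‖ * ‖a‖ ≤ (‖L‖ * ‖a‖) * ‖a‖ := by
            gcongr
            exact L.le_opNorm a
        _ = ‖L‖ * ‖a‖ ^ 2 := by ring
        _ ≤ _ := by gcongr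
    have e3 : (inner ℝ (q s) a : ℝ)
        ≤ ε * inner ℝ (q s) (fderiv ℝ P.A (y s) e) + |Q| * (b / 2 * (|ε| * ‖e‖) ^ 2) := by
      have h3 := h.norm_A_sub_sub_le (y s) (y s + ε • e)
      rw [add_sub_cancel_left, norm_smul, Real.norm_eq_abs, ← ha, map_smul] at h3
      have h4 : (inner ℝ (q s) (a - ε • fderiv ℝ P.A (y s) e) : ℝ)
          ≤ |Q| * (b / 2 * (|ε| * ‖e‖) ^ 2) := by
        refine (real_inner_le_norm _ _).trans ?_
        refine mul_le_mul ((hQ s hs).trans (le_abs_self Q)) (h3.trans ?_) (norm_nonneg _)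
          (abs_nonneg Q)
        gcongr
        exact div_le_self hb (by linarith [norm_nonneg (y s)])
      rw [inner_sub_right, inner_smul_right] at h4
      linarith
    have e4 := h.running.upper (y s) (y s + ε • e)
    rw [add_sub_cancel_left, inner_smul_right, norm_smul, Real.norm_eq_abs] at e4
    have e5 : (|ε| * ‖e‖) ^ 2 = ε ^ 2 * ‖e‖ ^ 2 := by rw [mul_pow, sq_abs]
    have e6 : (γ * (|ε| * ‖e‖)) ^ 2 = ε ^ 2 * (γ * ‖e‖) ^ 2 := by
      rw [mul_pow, e5]
      ring
    rw [e5] at e3 e4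
    rw [e6] at e2
    simp only [runningCost, hψ, Regular.inner_neg_adjoint_add_gradient, hC]
    linarith
  have hbase := hW.eq_add_integral h h1.le h2.le h12 hyc hqc hy fun s _ => rfl
  set c : ℝ := ∫ s in t₁..t₂, ψ s with hc
  have hineq : ∀ ε : ℝ, W (y t₁ + ε • e) t₁ ≤ W (y t₂ + ε • e) t₂
      + ((∫ s in t₁..t₂, P.runningCost y q s) + (-ε) * c + ε ^ 2 * C * (t₂ - t₁)) := by
    intro ε
    have hyε : ContinuousOn (fun s => y s + ε • e) (Icc t₁ t₂) := hyc.add continuousOn_const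
    have hqε : ContinuousOn (fun s => q s + L (P.A (y s + ε • e) - P.A (y s))) (Icc t₁ t₂) :=
      hqc.add (L.continuous.comp_continuousOn
        ((hA.comp_continuousOn hyε).sub (hA.comp_continuousOn hyc)))
    have h3 := hW.le_add_integral h h1.le h2.le h12 hyε hqε (fun s hs => by
      refine ((hy s hs).add_const (ε • e)).congr_deriv ?_
      rw [map_add, hL]
      abel)
    refine h3.trans (add_le_add le_rfl ?_)
    have hrcε := h.continuousOn_runningCost hyε hqε
    rw [← huIcc] at hrc hψc hrcε
    have hi0 : IntervalIntegrable (fun s => (-ε) * ψ s) volume t₁ t₂ :=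
      (continuousOn_const.mul hψc).intervalIntegrable
    have hi1 : IntervalIntegrable (fun s => P.runningCost y q s + (-ε) * ψ s) volume t₁ t₂ :=
      hrc.intervalIntegrable.add hi0
    have h4 := intervalIntegral.integral_mono_on h12 hrcε.intervalIntegrable
      (hi1.add (intervalIntegrable_const (c := ε ^ 2 * C))) (pointwise ε)
    refine h4.trans (le_of_eq ?_)
    rw [intervalIntegral.integral_add hi1 intervalIntegrable_const,
      intervalIntegral.integral_add hrc.intervalIntegrable hi0,
      intervalIntegral.integral_const_mul, intervalIntegral.integral_const, smul_eq_mul, hc]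
    ring
  -- The verification inequality holds for every translate and is an equality at `ε = 0`, so `φ` is
  -- minimal there. Its vanishing derivative is the tested adjoint equation, obtained without second
  -- derivatives of `W`.
  set φ : ℝ → ℝ := fun ε => W (y t₂ + ε • e) t₂ - W (y t₁ + ε • e) t₁ + (-ε) * c
    + ε ^ 2 * (C * (t₂ - t₁)) with hφ
  have hmin : IsLocalMin φ 0 := by
    refine Eventually.of_forall fun ε => ?_
    have := hineq ε
    simp only [hφ, zero_smul, add_zero]
    linarith
  have hline : ∀ t ∈ Ioo 0 P.T, ∀ z : H, HasDerivAt (fun ε : ℝ => W (z + ε • e) t)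
      (inner ℝ (spatialGradient W z t) e) 0 := by
    intro t ht z
    have h3 : HasFDerivAt (fun z => W z t)
        (InnerProductSpace.toDual ℝ H (spatialGradient W z t)) (z + (0 : ℝ) • e) := by
      rw [zero_smul, add_zero]
      exact (hW.hasGradientAt ht z).hasFDerivAt
    exact h3.comp_hasDerivAt (0 : ℝ) (hasDerivAt_line z e 0)
  have hφd : HasDerivAt φ ((inner ℝ (q t₂) e : ℝ) - inner ℝ (q t₁) e + (-1) * c
      + (2 * 0) * (C * (t₂ - t₁))) 0 := by
    refine (((hline t₂ (hJ (right_mem_Icc.2 h12)) (y t₂)).fun_sub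
      (hline t₁ (hJ (left_mem_Icc.2 h12)) (y t₁))).fun_add
      ((hasDerivAt_neg (0 : ℝ)).mul_const c)).fun_add ?_
    have := (hasDerivAt_pow 2 (0 : ℝ)).mul_const (C * (t₂ - t₁))
    simpa using this
  have := hmin.hasDerivAt_eq_zero hφd
  linarith

/-- Near every point there is a curve driven by its own gradient, and the gradient along it
satisfies the adjoint equation. -/
theorem exists_local_characteristic (h : P.Regular γ b ν M νT MT m)
    (hW : P.IsBellmanSolution (Ioo 0 P.T) W) {t₀ : ℝ} (ht₀ : t₀ ∈ Ioo 0 P.T) (x₀ : H) :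
    ∃ δ > 0, Ioo (t₀ - δ) (t₀ + δ) ⊆ Ioo 0 P.T ∧ ∃ y : ℝ → H, y t₀ = x₀ ∧
      ∀ s ∈ Ioo (t₀ - δ) (t₀ + δ), HasDerivAt (fun s => (y s, spatialGradient W (y s) s))
        (P.hamiltonianField (y s, spatialGradient W (y s) s)) s := by
  obtain ⟨r, hr, l, hlip⟩ := hW.locally_lipschitz_gradient t₀ ht₀ x₀
  obtain ⟨d, hd, hball⟩ := Metric.continuousWithinAt_iff.1
    (hW.continuousOn_spatialGradient (x₀, t₀) ⟨mem_univ _, ht₀⟩) 1 one_pos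
  obtain ⟨c, hc, hcsub⟩ := Metric.isOpen_iff.1 isOpen_Ioo t₀ ht₀
  -- Within distance `ρ` the gradient is Lipschitz (`r`), within 1 of its central value (`d`), and
  -- times stay in `(0, T)` (`c`).
  set ρ : ℝ := min (min r d) c / 2 with hρ
  have hρpos : 0 < ρ := by positivity
  have hρr : ρ < r := by
    have := (min_le_left (min r d) c).trans (min_le_left r d)
    linarith
  have hρd : ρ < d := by
    have := (min_le_left (min r d) c).trans (min_le_right r d)
    linarith
  have hρc : ρ < c := by
    have := min_le_right (min r d) c
    linarith
  set B : ℝ := γ * (‖x₀‖ + ρ) + ‖P.K‖ * (‖spatialGradient W x₀ t₀‖ + 1) with hB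
  have hγ := h.γ_nonneg
  have hB0 : 0 ≤ B := by positivity
  -- `B` bounds the speed on that neighbourhood, so `B δ ≤ ρ` keeps the curve inside it.
  set δ : ℝ := min ρ (ρ / (B + 1)) with hδ
  have hδpos : 0 < δ := by positivity
  have hδρ : δ ≤ ρ := min_le_left _ _
  have hBδ : B * δ ≤ ρ := by
    calc B * δ ≤ (B + 1) * (ρ / (B + 1)) :=
          mul_le_mul (by linarith) (min_le_right _ _) hδpos.le (by positivity)
      _ = ρ := by field_simp
  have htime : ∀ s ∈ Icc (t₀ - δ) (t₀ + δ), |s - t₀| ≤ ρ := fun s hs => by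
    rw [abs_le]
    constructor <;> linarith [hs.1, hs.2]
  have hmem : ∀ s ∈ Icc (t₀ - δ) (t₀ + δ), s ∈ Ioo 0 P.T := fun s hs => hcsub (by
    rw [Metric.mem_ball, Real.dist_eq]
    exact (htime s hs).trans_lt hρc)
  have hPL : IsPicardLindelof (fun s x => P.A x - P.K (spatialGradient W x s))
      (⟨t₀, by constructor <;> linarith⟩ : Icc (t₀ - δ) (t₀ + δ)) x₀ ⟨ρ, hρpos.le⟩ 0 ⟨B, hB0⟩
      ⟨γ + ‖P.K‖ * |l|, by positivity⟩ := by
    refine ⟨fun s hs => LipschitzOnWith.of_dist_le_mul fun x hx z hz => ?_, fun x _ => ?_,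
      fun s hs x hx => ?_, ?_⟩
    · have h3 := hlip s (hmem s hs) ((htime s hs).trans_lt hρr) x
        (Metric.closedBall_subset_ball hρr hx) z (Metric.closedBall_subset_ball hρr hz)
      rw [dist_eq_norm, dist_eq_norm]
      change _ ≤ (γ + ‖P.K‖ * |l|) * _
      have e : P.A x - P.K (spatialGradient W x s) - (P.A z - P.K (spatialGradient W z s))
          = (P.A x - P.A z) - P.K (spatialGradient W x s - spatialGradient W z s) := by
        rw [map_sub]
        abel
      rw [e]
      refine (norm_sub_le _ _).trans ?_
      have h4 := h.norm_A_sub_le x z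
      have h5 : ‖P.K (spatialGradient W x s - spatialGradient W z s)‖
          ≤ ‖P.K‖ * (|l| * ‖x - z‖) := by
        refine (P.K.le_opNorm _).trans ?_
        gcongr
        refine h3.trans ?_
        gcongr
        exact le_abs_self l
      linarith
    · exact continuousOn_const.sub (P.K.continuous.comp_continuousOn
        (hW.continuousOn_spatialGradient_comp hmem continuousOn_const))
    · have h3 : dist (spatialGradient W x s) (spatialGradient W x₀ t₀) < 1 := by
        refine hball (x := (x, s)) ⟨mem_univ _, hmem s hs⟩ (max_lt ?_ ?_)
        · exact lt_of_le_of_lt hx hρd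
        · exact lt_of_le_of_lt (htime s hs) hρd
      have h4 : ‖spatialGradient W x s‖ ≤ ‖spatialGradient W x₀ t₀‖ + 1 := by
        rw [dist_eq_norm] at h3
        have := norm_le_norm_add_norm_sub' (spatialGradient W x s) (spatialGradient W x₀ t₀)
        linarith
      have h5 : ‖x‖ ≤ ‖x₀‖ + ρ := by
        have h6 : dist x x₀ ≤ ρ := hx
        rw [dist_eq_norm] at h6
        have := norm_le_norm_add_norm_sub' x x₀
        linarith
      refine (norm_sub_le _ _).trans (add_le_add ((h.norm_A_le x).trans ?_)
        ((P.K.le_opNorm _).trans ?_)) <;> gcongr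
    · change B * max (t₀ + δ - t₀) (t₀ - (t₀ - δ)) ≤ ρ - 0
      simpa using hBδ
  obtain ⟨y, hy0, hy⟩ := hPL.exists_eq_forall_mem_Icc_hasDerivWithinAt₀
  have hyd : ∀ s ∈ Ioo (t₀ - δ) (t₀ + δ),
      HasDerivAt y (P.A (y s) - P.K (spatialGradient W (y s) s)) s := fun s hs =>
    (hy s (Ioo_subset_Icc_self hs)).hasDerivAt (Icc_mem_nhds hs.1 hs.2)
  have hyc : ContinuousOn y (Ioo (t₀ - δ) (t₀ + δ)) :=
    fun s hs => (hyd s hs).continuousAt.continuousWithinAt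
  have hsub : Ioo (t₀ - δ) (t₀ + δ) ⊆ Ioo 0 P.T := fun s hs => hmem s (Ioo_subset_Icc_self hs)
  have hqc := hW.continuousOn_spatialGradient_comp hsub hyc
  refine ⟨δ, hδpos, hsub, y, hy0, fun s hs => (hyd s hs).prodMk ?_⟩
  set p' : ℝ → H := fun s => -(ContinuousLinearMap.adjoint (fderiv ℝ P.A (y s))
    (spatialGradient W (y s) s) + gradient P.F (y s)) with hp'
  have hp'c : ContinuousOn p' (Ioo (t₀ - δ) (t₀ + δ)) := by
    refine ContinuousOn.neg (ContinuousOn.add ?_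
      (h.running.continuous_gradient.comp_continuousOn hyc))
    exact ((ContinuousLinearMap.adjoint (𝕜 := ℝ) (E := H) (F := H)).continuous.comp_continuousOn
      (h.continuous_fderiv.comp_continuousOn hyc)).clm_apply hqc
  have ht₀' : t₀ ∈ Ioo (t₀ - δ) (t₀ + δ) := by constructor <;> linarith
  have hsegment : ∀ s₁ ∈ Ioo (t₀ - δ) (t₀ + δ), ∀ s₂ ∈ Ioo (t₀ - δ) (t₀ + δ), s₁ ≤ s₂ →
      spatialGradient W (y s₂) s₂ - spatialGradient W (y s₁) s₁ = ∫ u in s₁..s₂, p' u := by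
    intro s₁ hs₁ s₂ hs₂ h12
    have hI : Icc s₁ s₂ ⊆ Ioo (t₀ - δ) (t₀ + δ) :=
      fun u hu => ⟨hs₁.1.trans_le hu.1, hu.2.trans_lt hs₂.2⟩
    have hint : IntervalIntegrable p' volume s₁ s₂ := by
      refine ContinuousOn.intervalIntegrable ?_
      rw [uIcc_of_le h12]
      exact hp'c.mono hI
    refine ext_inner_right ℝ fun e => ?_
    rw [inner_sub_left, hW.inner_spatialGradient_sub h (hsub hs₁).1 (hsub hs₂).2 h12 (hyc.mono hI)
      (fun u hu => hyd u (hI (Ioo_subset_Icc_self hu))) e, real_inner_comm]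
    have h3 := (innerSL ℝ e).intervalIntegral_comp_comm hint
    refine Eq.trans ?_ h3
    refine intervalIntegral.integral_congr fun u _ => ?_
    exact real_inner_comm _ _
  have hprim : ∀ s ∈ Ioo (t₀ - δ) (t₀ + δ), spatialGradient W (y s) s
      = spatialGradient W (y t₀) t₀ + ∫ u in t₀..s, p' u := by
    intro s hs
    rcases le_total t₀ s with hle | hle
    · rw [← hsegment t₀ ht₀' s hs hle]
      abel
    · rw [intervalIntegral.integral_symm, ← hsegment s hs t₀ ht₀' hle]
      abel
  have h3 := (hasDerivAt_integral_of_continuousOn_Ioo hp'c ht₀' hs).const_add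
    (spatialGradient W (y t₀) t₀)
  refine h3.congr_of_eventuallyEq ?_
  filter_upwards [isOpen_Ioo.mem_nhds hs] with u hu using hprim u hu

/-- A Hamiltonian curve that starts on the graph of the gradient of a solution remains on it. -/
theorem adjoint_eq_spatialGradient (h : P.Regular γ b ν M νT MT m)
    (hW : P.IsBellmanSolution (Ioo 0 P.T) W) {x p : ℝ → H} (hxp : P.IsHamiltonianCurve x p) {t : ℝ}
    (ht : t ∈ Ioo 0 P.T) (hp : p t = spatialGradient W (x t) t) :
    ∀ s ∈ Ioo 0 P.T, p s = spatialGradient W (x s) s := by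
  have htime : Ioo 0 P.T ⊆ Ioo (-1) (P.T + 1) := Ioo_subset_Icc_self.trans P.Icc_subset_Ioo_time
  set S : Set ℝ := {s | s ∈ Ioo 0 P.T ∧ p s = spatialGradient W (x s) s} with hS
  suffices Ioo 0 P.T ⊆ S from fun s hs => (this hs).2
  -- Connectedness: the contact set is open, since near a contact time both the curve and the local
  -- characteristic solve the same Hamiltonian system with the same data, and relatively closed by
  -- continuity.
  refine isPreconnected_Ioo.subset_of_closure_inter_subset ?_ ⟨t, ht, ht, hp⟩ ?_
  · rw [isOpen_iff_mem_nhds]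
    rintro t₀ ⟨ht₀, hp₀⟩
    obtain ⟨δ, hδ, hsub, y, hy0, hy⟩ := hW.exists_local_characteristic h ht₀ (x t₀)
    set a := t₀ - δ / 2 with ha
    set c := t₀ + δ / 2 with hc
    have hI : Icc a c ⊆ Ioo (t₀ - δ) (t₀ + δ) :=
      fun s hs => ⟨by linarith [hs.1], by linarith [hs.2]⟩
    have hI' : Icc a c ⊆ Ioo (-1) (P.T + 1) := hI.trans (hsub.trans htime)
    have hd1 : ∀ s ∈ Icc a c,
        HasDerivAt (fun s => (x s, p s)) (P.hamiltonianField (x s, p s)) s :=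
      fun s hs => (hxp.state s (hI' hs)).prodMk (hxp.adjoint s (hI' hs))
    have hd2 := fun s (hs : s ∈ Icc a c) => hy s (hI hs)
    have hc1 : ContinuousOn (fun s => (x s, p s)) (Icc a c) :=
      fun s hs => (hd1 s hs).continuousAt.continuousWithinAt
    have hc2 : ContinuousOn (fun s => (y s, spatialGradient W (y s) s)) (Icc a c) :=
      fun s hs => (hd2 s hs).continuousAt.continuousWithinAt
    obtain ⟨R₁, hR₁⟩ := isCompact_Icc.exists_bound_of_continuousOn hc1
    obtain ⟨R₂, hR₂⟩ := isCompact_Icc.exists_bound_of_continuousOn hc2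
    obtain ⟨L, hL⟩ := h.lipschitzOnWith_hamiltonianField (max R₁ R₂)
    have heq := ODE_solution_unique_of_mem_Icc (v := fun _ => P.hamiltonianField)
      (s := fun _ => Metric.closedBall 0 (max R₁ R₂)) (K := L) (t₀ := t₀) (a := a) (b := c)
      (fun _ _ => hL) ⟨by linarith, by linarith⟩ hc1
      (fun s hs => hd1 s (Ioo_subset_Icc_self hs))
      (fun s hs => mem_closedBall_zero_iff.2
        ((hR₁ s (Ioo_subset_Icc_self hs)).trans (le_max_left _ _))) hc2
      (fun s hs => hd2 s (Ioo_subset_Icc_self hs))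
      (fun s hs => mem_closedBall_zero_iff.2
        ((hR₂ s (Ioo_subset_Icc_self hs)).trans (le_max_right _ _)))
      (by simp only [hy0, hp₀])
    filter_upwards [Icc_mem_nhds (show a < t₀ by linarith) (show t₀ < c by linarith)] with s hs
    have h3 := heq hs
    simp only [Prod.mk.injEq] at h3
    refine ⟨hsub (hI hs), ?_⟩
    rw [h3.2, h3.1]
  · rintro s ⟨hcl, hs⟩
    refine ⟨hs, ?_⟩
    by_contra hne
    have hcont : ContinuousOn (fun s => p s - spatialGradient W (x s) s) (Ioo 0 P.T) :=
      (hxp.continuousOn_adjoint.mono htime).sub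
        (hW.continuousOn_spatialGradient_comp subset_rfl (hxp.continuousOn_state.mono htime))
    have hev := (hcont.continuousAt (isOpen_Ioo.mem_nhds hs)).eventually_ne (sub_ne_zero.2 hne)
    obtain ⟨u, hu1, hu2⟩ := (mem_closure_iff_frequently.1 hcl).and_eventually hev |>.exists
    exact hu2 (sub_eq_zero.2 hu1.2)

end IsBellmanSolution

namespace Controlled

variable {P : ControlProblem H U} {γ b ν M νT MT m α : ℝ} {W : H → ℝ → ℝ}

theorem solution_le_value (h : P.Controlled γ b ν M νT MT m α)
    (hW : P.IsBellmanSolution (Ioo 0 P.T) W) (x₀ : H) {t : ℝ} (ht : t ∈ Icc 0 P.T) :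
    W x₀ t ≤ P.value x₀ t := by
  obtain ⟨x, p, he, rfl⟩ := h.exists_isExtremal x₀ ht
  have hsub : Icc t P.T ⊆ Ioo (-1) (P.T + 1) :=
    (Icc_subset_Icc_left ht.1).trans P.Icc_subset_Ioo_time
  have := hW.le_add_integral h.toRegular ht.1 le_rfl ht.2 (he.continuousOn_state.mono hsub)
    (he.continuousOn_adjoint.mono hsub) fun s hs => he.state s (hsub (Ioo_subset_Icc_self hs))
  rw [hW.terminal] at this
  rw [h.value_eq he ht]
  linarith

/-- The Hamiltonian curve started with `p(t) = D_xW` exists up to `T` and stays on the graph of the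
gradient, so `W` is the payoff of its feedback control. Transversality is not needed, as any
admissible payoff bounds the infimum from above. -/
theorem value_le_solution (h : P.Controlled γ b ν M νT MT m α)
    (hW : P.IsBellmanSolution (Ioo 0 P.T) W) (x₀ : H) {t : ℝ} (ht : t ∈ Ioo 0 P.T) :
    P.value x₀ t ≤ W x₀ t := by
  have ht' := Ioo_subset_Icc_self ht
  obtain ⟨x, p, hxp, rfl, hp⟩ := h.exists_isHamiltonianCurve ht' x₀ (spatialGradient W x₀ t)
  have hgrad := hW.adjoint_eq_spatialGradient h.toRegular hxp ht hp
  have hsub : Icc t P.T ⊆ Ioo (-1) (P.T + 1) :=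
    (Icc_subset_Icc_left ht.1.le).trans P.Icc_subset_Ioo_time
  have := hW.eq_add_integral h.toRegular ht.1.le le_rfl ht.2.le (hxp.continuousOn_state.mono hsub)
    (hxp.continuousOn_adjoint.mono hsub) (fun s hs => hxp.state s (hsub (Ioo_subset_Icc_self hs)))
    fun s hs => hgrad s ⟨ht.1.trans hs.1, hs.2⟩
  rw [this, hW.terminal, add_comm, ← h.payoff_feedback hxp ht']
  exact (h.isGLB_value (x t) ht').1 ⟨_, _, hxp.isControl ht', h.isState hxp ht', rfl⟩

/-- The two inequalities meet at interior times; the endpoints follow by continuity in time. -/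
theorem solution_eq_value (h : P.Controlled γ b ν M νT MT m α)
    (hW : P.IsBellmanSolution (Ioo 0 P.T) W) (x₀ : H) {t : ℝ} (ht : t ∈ Icc 0 P.T) :
    W x₀ t = P.value x₀ t := by
  have hIoo : EqOn (W x₀) (P.value x₀) (Ioo 0 P.T) := fun s hs =>
    le_antisymm (h.solution_le_value hW x₀ (Ioo_subset_Icc_self hs)) (h.value_le_solution hW x₀ hs)
  have hslice : ∀ {V : H → ℝ → ℝ},
      ContinuousOn (fun q : H × ℝ => V q.1 q.2) (univ ×ˢ Icc 0 P.T) →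
      ContinuousOn (V x₀) (Icc 0 P.T) := fun hV =>
    hV.comp (f := fun s => (x₀, s)) (continuousOn_const.prodMk continuousOn_id)
      fun s hs => ⟨mem_univ _, hs⟩
  refine hIoo.of_subset_closure (hslice hW.continuousOn) (hslice h.continuousOn_value)
    Ioo_subset_Icc_self ?_ ht
  rw [closure_Ioo h.T_pos.ne]

end Controlled

end ControlProblem

end HamiltonJacobi

theorem mainTheorem4 {H U : Type*}
    [NormedAddCommGroup H] [InnerProductSpace ℝ H] [CompleteSpace H]
    [NormedAddCommGroup U] [InnerProductSpace ℝ U] [CompleteSpace U]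
    (P : ControlProblem H U) (γ b ν M νT MT m k : ℝ)
    (hT : 0 < P.T)
    -- the drift
    (hA0 : P.A 0 = 0)
    (hA1 : ContDiff ℝ 1 P.A)
    (hA2 : Differentiable ℝ (fderiv ℝ P.A))
    (hAγ : ∀ x : H, ‖fderiv ℝ P.A x‖ ≤ γ)
    (hAb : ∀ x₁ x₂ : H,
      ‖fderiv ℝ P.A x₁ - fderiv ℝ P.A x₂‖ ≤ b * ‖x₁ - x₂‖ / (1 + max ‖x₁‖ ‖x₂‖))
    -- the running payoff
    (hF2 : ContDiff ℝ 2 P.F)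
    (hF0 : P.F 0 = 0)
    (hDF0 : gradient P.F 0 = 0)
    (hν : 0 < ν)
    (hFν : ∀ x ξ : H, ν * ‖ξ‖ ^ 2 ≤ fderiv ℝ (fderiv ℝ P.F) x ξ ξ)
    (hFM : ∀ x ξ : H, fderiv ℝ (fderiv ℝ P.F) x ξ ξ ≤ M * ‖ξ‖ ^ 2)
    -- the terminal payoff
    (hFT2 : ContDiff ℝ 2 P.FT)
    (hFT0 : P.FT 0 = 0)
    (hDFT0 : gradient P.FT 0 = 0)
    (hνT : 0 < νT)
    (hFTν : ∀ x ξ : H, νT * ‖ξ‖ ^ 2 ≤ fderiv ℝ (fderiv ℝ P.FT) x ξ ξ)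
    (hFTM : ∀ x ξ : H, fderiv ℝ (fderiv ℝ P.FT) x ξ ξ ≤ MT * ‖ξ‖ ^ 2)
    -- the control operators
    (hNsa : IsSelfAdjoint (P.N : U →L[ℝ] U))
    (hNpos : ∀ v : U, 0 ≤ inner ℝ v (P.N v))
    (hm : 0 < m)
    (hK : ∀ ξ : H, m * ‖ξ‖ ^ 2 ≤ inner ℝ (P.K ξ) ξ)
    -- the conditions on the constants
    (hk : 0 < k)
    (hk' : k < min m ν)
    (hb : b ^ 2 / 16 < (m - k) * (ν - k))
    (hα : 0 < ν - b * (MT ^ 2 / νT + (γ ^ 2 + M ^ 2) / k * P.T))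
    (hγ : γ ^ 2 < M * ‖P.K‖) :
    -- the infimum that defines the value function is a genuine one
    (∀ x : H, ∀ t ∈ Set.Icc 0 P.T, IsGLB (P.payoffs x t) (P.value x t)) ∧
    -- the value function solves the equation on the whole of `[0, T]`
    P.IsBellmanSolution (Set.Icc 0 P.T) P.value ∧
    -- and it is the only solution, even among those that solve it on `(0, T)` only
    (∀ W : H → ℝ → ℝ, P.IsBellmanSolution (Set.Ioo 0 P.T) W →
      ∀ x : H, ∀ t ∈ Set.Icc 0 P.T, W x t = P.value x t) := by
  have hM0 : 0 < M * ‖P.K‖ := (sq_nonneg γ).trans_lt hγ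
  -- On the zero space `K = 0`, which contradicts `γ² < M‖K‖`. A nonzero vector is what makes the
  -- Hessian and Lipschitz bounds force `M, M_T > 0` and `b ≥ 0`.
  have hnt : Nontrivial H := by
    by_contra hcon
    rw [not_nontrivial_iff_subsingleton] at hcon
    rw [Subsingleton.elim P.K 0, norm_zero, mul_zero] at hM0
    exact lt_irrefl 0 hM0
  have hF := ControlProblem.IsConvexPayoff.of_hessian hF2 hDF0 hν hFν hFM
  have hFT := ControlProblem.IsConvexPayoff.of_hessian hFT2 hDFT0 hνT hFTν hFTM
  have hγ0 : 0 ≤ γ := (norm_nonneg _).trans (hAγ 0)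
  have hb0 : 0 ≤ b := by
    obtain ⟨ξ, hξ⟩ := exists_ne (0 : H)
    have h1 := (norm_nonneg _).trans (hAb ξ 0)
    rw [sub_zero, norm_zero, max_eq_left (norm_nonneg ξ), mul_div_assoc] at h1
    have h2 : 0 < ‖ξ‖ / (1 + ‖ξ‖) := by positivity
    exact nonneg_of_mul_nonneg_left h1 h2
  have hreg : P.Regular γ b ν M νT MT m :=
    ⟨hT, hγ0, hb0, hm, hA0, hA1.differentiable one_ne_zero, hAγ, hAb, hF, hFT,
      fun u v => hNsa.isSymmetric u v, hNpos, hK⟩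
  have h : P.Controlled γ b ν M νT MT m (MT ^ 2 / νT + (γ ^ 2 + M ^ 2) / k * P.T) :=
    ⟨hreg, by positivity, by linarith, fun x p he s hs =>
      hreg.norm_adjoint_le_mul_norm_state hk (hk'.trans_le (min_le_left _ _)) hb he hs⟩
  exact ⟨fun x t ht => h.isGLB_value x ht, h.isBellmanSolution_value,
    fun W hW x t ht => h.solution_eq_value hW x ht⟩
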